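/- Let $P=(p_{xy})$ be the transition matrix of an ergodic (irreducible and aperiodic) Markov chain on a finite set $X$, $|X|=n$, with stationary distribution $\pi$, and suppose that $P$ is reversible: $P=P^*$, where $P^*=(p^*_{yx})$ is given by $\pi_x p_{xy}=\pi_y p^*_{yx}$. In $\mathcal H=\mathbb C^{X\times X}$ put $|p_x\rangle=\sum_y\sqrt{p_{xy}}\,|y\rangle$, $|p^*_y\rangle=\sum_x\sqrt{p^*_{yx}}\,|x\rangle$, $\mathcal A=\mathrm{Span}(|x\rangle|p_x\rangle : x\in X)$, $\mathcal B=\mathrm{Span}(|p^*_y\rangle|y\rangle : y\in X)$, $W(P)=\mathrm{ref}(\mathcal B)\,\mathrm{ref}(\mathcal A)$ with $\mathrm{ref}(\mathcal K)=2\Pi_{\mathcal K}-\mathrm{Id}$, and $|\pi\rangle=\sum_x\sqrt{\pi_x}\,|x\rangle|p_x\rangle$. Let $D(P)=(\sqrt{p_{xy}p^*_{yx}})_{x,y}$ and let $\Delta(P)=2\theta$, where $\theta$ is the smallest angle in $(0,\pi/2)$ such that $\cos\theta$ is a singular value of $D(P)$; if there is no such angle, put $\Delta(P)=\pi$ (the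 number). A circuit on $N$ qubits acts on $\mathcal H\otimes(\mathbb C^2)^{\otimes N}$, that is, on the $n^2$-dimensional walk register together with $N$ qubits. Its gates are Hadamard gates, controlled phase rotations by $e^{\pm 2\pi i/2^l}$ ($l\ge 0$), the classical reversible gates NOT, CNOT and Toffoli (all on the $N$ qubits), and calls to the controlled walk $\mathrm{c}\text{-}W(P)$ and its inverse $\mathrm{c}\text{-}W(P)^\dagger$, controlled by one of the qubits; the walk register is touched only by these calls. Then there are absolute constants $c>0$ and $C$ and a uniform family of circuits $R_{k,s}$ on $ks$ qubits ($k,s\ge 0$ integers) such that, for every $P$ as above, there is an integer $s$ with $|s-\log_2(1/\Delta(P))|\le C$ for which the following holds for every integer $k\ge 0$. Write $R(P)$ for the operator on $\mathcal H\otimes(\mathbb C^2)^{\otimes ks}$ implemented by $R_{k,s}$ with calls to $\mathrm{c}\text{-}W(P)$ and its inverse. 1. The circuit uses exactly $2ks$ Hadamard gates and at most $C\,k s^2$ controlled phase rotations, and makes at most $k\,2^{s+1}$ calls in total to $\mathrm{c}\text{-}W(P)$ and $\mathrm{c}\text{-}W(P)^\dagger$. 2. $R(P)\,|\pi\rangle|0^{ks}\rangle=|\pi\rangle|0^{ks}\rangle$.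 3. If $|\psi\rangle\in\mathcal A+\mathcal B$ is orthogonal to $|\pi\rangle$, then $\|(R(P)+\mathrm{Id})\,|\psi\rangle|0^{ks}\rangle\|\le 2^{1-ck}\,\||\psi\rangle\|$. Here uniform means that one fixed program (a structured program over natural-number registers with increment, decrement, zero test, bounded loop and print instructions, each elementary operation costing one step) prints, on input $(k,s)$, the list of gates of $R_{k,s}$ in a number of steps polynomial in $k$ and $2^s$. In particular the list of gates depends only on $k$ and $s$, not on $P$ or $n$, which enter only through the calls to the walk. -/

import Mathlib

open scoped Matrix

noncomputable section

namespace QWalk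

/-! ### Finite Markov chains -/

section Chain

variable {X : Type*} [Fintype X] [DecidableEq X]

/-- `P` is the transition matrix of an ergodic (irreducible and aperiodic) Markov chain on `X`. -/
structure IsErgodic (P : Matrix X X ℝ) : Prop where
  stochastic : P ∈ Matrix.rowStochastic ℝ X
  irreducible : P.IsIrreducible
  /-- Every state has period one: the gcd of its return times is one. -/
  aperiodic : ∀ (x : X) (d : ℕ), (∀ t : ℕ, 0 < t → 0 < (P ^ t) x x → d ∣ t) → d = 1

/-- `π` is a stationary probability distribution of `P`. -/
structure IsStationary (P : Matrix X X ℝ) (π : X → ℝ) : Prop where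
  nonneg : ∀ x, 0 ≤ π x
  sum_eq_one : ∑ x, π x = 1
  stationary : π ᵥ* P = π

/-- The time-reversed chain `P*`, with `π x * P x y = π y * P* y x`. -/
def timeReversal (P : Matrix X X ℝ) (π : X → ℝ) : Matrix X X ℝ :=
  Matrix.of fun y x => π x * P x y / π y

/-- The chain equals its time reversal. -/
def IsReversible (P : Matrix X X ℝ) (π : X → ℝ) : Prop :=
  timeReversal P π = P

/-- The discriminant matrix, with entries `√(p_{xy} p*_{yx})`. -/
def discriminant (P : Matrix X X ℝ) (π : X → ℝ) : Matrix X X ℝ :=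
  Matrix.of fun x y => Real.sqrt (P x y * timeReversal P π y x)

/-- The phase gap `Δ(P) = 2θ`, where `θ` is the smallest angle in `(0, π/2)` such that `cos θ` is
a singular value of the discriminant. If there is no such angle (so that, on `A + B`, the walk
has no eigenvalues other than `1` and possibly `-1`), the value is `Real.pi`. -/
def phaseGap (P : Matrix X X ℝ) (π : X → ℝ) : ℝ :=
  sInf (insert Real.pi
    {δ : ℝ | ∃ θ ∈ Set.Ioo 0 (Real.pi / 2), δ = 2 * θ ∧
      ∃ i < Fintype.card X,
        (Matrix.toEuclideanLin (discriminant P π)).singularValues i = Real.cos θ})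

/-! ### The quantum walk on `ℂ^(X × X)` -/

/-- The vector `|x⟩|p_x⟩`, where `|p_x⟩ = ∑ y, √p_{xy} |y⟩`. -/
def outVec (P : Matrix X X ℝ) (x : X) : EuclideanSpace ℂ (X × X) :=
  WithLp.toLp 2 fun v => if v.1 = x then (Real.sqrt (P x v.2) : ℂ) else 0

/-- The vector `|p*_y⟩|y⟩`, where `|p*_y⟩ = ∑ x, √p*_{yx} |x⟩`. -/
def inVec (P : Matrix X X ℝ) (π : X → ℝ) (y : X) : EuclideanSpace ℂ (X × X) :=
  WithLp.toLp 2 fun v => if v.2 = y then (Real.sqrt (timeReversal P π y v.1) : ℂ) else 0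

/-- The subspace `A`, spanned by the vectors `|x⟩|p_x⟩`. -/
def spaceA (P : Matrix X X ℝ) : Submodule ℂ (EuclideanSpace ℂ (X × X)) :=
  Submodule.span ℂ (Set.range (outVec P))

/-- The subspace `B`, spanned by the vectors `|p*_y⟩|y⟩`. -/
def spaceB (P : Matrix X X ℝ) (π : X → ℝ) : Submodule ℂ (EuclideanSpace ℂ (X × X)) :=
  Submodule.span ℂ (Set.range (inVec P π))

/-- The quantum walk `W(P) = ref(B) · ref(A)` (first `ref(A)`, then `ref(B)`), where
`ref(K) = 2 Π_K - Id`. -/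
def walk (P : Matrix X X ℝ) (π : X → ℝ) :
    EuclideanSpace ℂ (X × X) ≃ₗᵢ[ℂ] EuclideanSpace ℂ (X × X) :=
  (spaceA P).reflection.trans (spaceB P π).reflection

/-- The state `|π⟩ = ∑ x, √π_x |x⟩|p_x⟩`. -/
def stationaryState (P : Matrix X X ℝ) (π : X → ℝ) : EuclideanSpace ℂ (X × X) :=
  ∑ x, (Real.sqrt (π x) : ℂ) • outVec P x

end Chain

/-! ### Circuits with calls to a controlled unitary -/

/-- Gates on a set `Q` of qubits and one further register, the target register, on which a
unitary `U` acts. The target register is only touched by calls to the controlled `U` and its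
inverse. -/
inductive Gate (Q : Type)
  | hadamard (i : Q)
  /-- Controlled phase rotation: multiplies by `exp (± 2πi / 2^l)` if qubits `i` and `j` are
  both one, with sign `-` if `inv` is true. -/
  | cphase (i j : Q) (l : ℕ) (inv : Bool)
  /-- The classical reversible gates NOT, CNOT (target `t`) and Toffoli (target `t`). -/
  | not (t : Q)
  | cnot (i t : Q)
  | toffoli (i j t : Q)
  /-- A call to the controlled unitary, with control qubit `i`. -/
  | call (i : Q)
  /-- A call to the inverse of the controlled unitary, with control qubit `i`. -/
  | callInv (i : Q)

namespace Gate

variable {Q Q' : Type}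

/-- The qubits on which a gate acts are distinct. -/
def Valid : Gate Q → Prop
  | cphase i j _ _ => i ≠ j
  | cnot i t => i ≠ t
  | toffoli i j t => i ≠ j ∧ i ≠ t ∧ j ≠ t
  | _ => True

def isHadamard : Gate Q → Bool
  | hadamard _ => true
  | _ => false

def isPhase : Gate Q → Bool
  | cphase _ _ _ _ => true
  | _ => false

def isCall : Gate Q → Bool
  | call _ => true
  | callInv _ => true
  | _ => false

/-- Rename the qubits by `f` and change the rotation parameter by `g`. -/
def rename (f : Q → Q') (g : ℕ → ℕ) : Gate Q → Gate Q'
  | hadamard i => hadamard (f i)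
  | cphase i j l inv => cphase (f i) (f j) (g l) inv
  | not t => not (f t)
  | cnot i t => cnot (f i) (f t)
  | toffoli i j t => toffoli (f i) (f j) (f t)
  | call i => call (f i)
  | callInv i => callInv (f i)

end Gate

/-- A circuit is a list of gates; the head of the list is applied first. -/
abbrev Circuit (Q : Type) := List (Gate Q)

/-- All gates of the circuit act on distinct qubits. -/
def Circuit.Valid {Q : Type} (C : Circuit Q) : Prop := ∀ g ∈ C, g.Valid

section Semantics

variable {V : Type*} {Q : Type} [DecidableEq Q]

/-- The space `ℂ^V ⊗ (ℂ²)^{⊗ Q}`, in coordinates: `V` indexes the basis of the target register,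
and `Q → Bool` the computational basis of the qubits. -/
abbrev Joint (V : Type*) (Q : Type) := EuclideanSpace ℂ (V × (Q → Bool))

/-- The component of `Ψ` along the basis state `b` of the qubits. -/
def slice (Ψ : Joint V Q) (b : Q → Bool) : EuclideanSpace ℂ V :=
  WithLp.toLp 2 fun v => Ψ (v, b)

/-- The state `|ψ⟩|0…0⟩`. -/
def withZeros [Fintype Q] (ψ : EuclideanSpace ℂ V) : Joint V Q :=
  WithLp.toLp 2 fun w => if w.2 = fun _ => false then ψ w.1 else 0

variable [Fintype V]

/-- The action of a gate, where `U` is the unitary on the target register that `call` and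
`callInv` refer to. -/
def Gate.apply (U : EuclideanSpace ℂ V ≃ₗᵢ[ℂ] EuclideanSpace ℂ V) :
    Gate Q → Joint V Q → Joint V Q
  | .hadamard i, Ψ => WithLp.toLp 2 fun w =>
      (Ψ (w.1, Function.update w.2 i false) +
        (if w.2 i then -1 else 1) * Ψ (w.1, Function.update w.2 i true)) / (Real.sqrt 2 : ℂ)
  | .cphase i j l inv, Ψ => WithLp.toLp 2 fun w =>
      (if w.2 i && w.2 j then
        Complex.exp ((if inv then -1 else 1) * (2 * Real.pi * Complex.I) / 2 ^ l) else 1) * Ψ w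
  | .not t, Ψ => WithLp.toLp 2 fun w =>
      Ψ (w.1, Function.update w.2 t (!(w.2 t)))
  | .cnot i t, Ψ => WithLp.toLp 2 fun w =>
      Ψ (w.1, Function.update w.2 t (xor (w.2 t) (w.2 i)))
  | .toffoli i j t, Ψ => WithLp.toLp 2 fun w =>
      Ψ (w.1, Function.update w.2 t (xor (w.2 t) (w.2 i && w.2 j)))
  | .call i, Ψ => WithLp.toLp 2 fun w =>
      if w.2 i then U (slice Ψ w.2) w.1 else Ψ w
  | .callInv i, Ψ => WithLp.toLp 2 fun w =>
      if w.2 i then U.symm (slice Ψ w.2) w.1 else Ψ w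

/-- The action of a circuit on a state. -/
def Circuit.apply (U : EuclideanSpace ℂ V ≃ₗᵢ[ℂ] EuclideanSpace ℂ V) (C : Circuit Q)
    (Ψ : Joint V Q) : Joint V Q :=
  C.foldl (fun Φ g => g.apply U Φ) Ψ

end Semantics

/-! ### Uniformity: circuits printed by a program with a step count -/

/-- Structured programs over registers that hold natural numbers and are named by `ℕ`. -/
inductive Prog
  | skip
  | inc (r : ℕ)
  | dec (r : ℕ)
  | seq (p q : Prog)
  /-- Run `p` if register `r` holds zero, and `q` otherwise. -/
  | ifZero (r : ℕ) (p q : Prog)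
  /-- Run `p` as many times as register `r` says when the loop is entered. -/
  | loop (r : ℕ) (p : Prog)
  /-- Print a gate, whose qubits and rotation parameter are read from the named registers. -/
  | emit (g : Gate ℕ)

/-- Contents of the registers, the gates printed so far, and the number of steps so far. -/
structure Config where
  reg : ℕ → ℕ
  out : List (Gate ℕ)
  steps : ℕ

/-- Execution of a program. Each elementary instruction, each test and each start of a loop or of
one of its rounds costs one step. -/
def Prog.exec : Prog → Config → Config
  | skip, c => { c with steps := c.steps + 1 }
  | inc r, c =>
      { c with reg := Function.update c.reg r (c.reg r + 1), steps := c.steps + 1 }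
  | dec r, c =>
      { c with reg := Function.update c.reg r (c.reg r - 1), steps := c.steps + 1 }
  | seq p q, c => q.exec (p.exec c)
  | ifZero r p q, c =>
      if c.reg r = 0 then p.exec { c with steps := c.steps + 1 }
      else q.exec { c with steps := c.steps + 1 }
  | loop r p, c =>
      (fun e : Config => p.exec { e with steps := e.steps + 1 })^[c.reg r]
        { c with steps := c.steps + 1 }
  | emit g, c =>
      { c with out := c.out ++ [g.rename c.reg c.reg], steps := c.steps + 1 }

/-- Start with `k` in register `0`, `s` in register `1`, and all other registers zero. -/
def Config.start (k s : ℕ) : Config where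
  reg := fun r => if r = 0 then k else if r = 1 then s else 0
  out := []
  steps := 0

/-- The family `R` of circuits on `k * s` qubits is uniform: one fixed program prints, on input
`(k, s)`, the description of `R k s` in a number of steps polynomial in `k` and `2 ^ s`. -/
def IsUniform (R : (k s : ℕ) → Circuit (Fin (k * s))) : Prop :=
  ∃ (p : Prog) (d : ℕ), ∀ k s : ℕ,
    (p.exec (Config.start k s)).out =
        List.map (Gate.rename (fun i : Fin (k * s) => (i : ℕ)) id) (R k s) ∧
      (p.exec (Config.start k s)).steps ≤ d * (k + 2 ^ s) ^ d

end QWalk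

end

/-! Gap of the walk. The displacement is ‖ψ − Wψ‖ = 2‖Π_A ψ − Π_B ψ‖, and on the part of A + B
orthogonal to |π⟩ the operator (Π_A − Π_B)² is at least sin²(Δ/2). This bound comes from the
discriminant D, the Gram matrix between the two orthonormal families that span A and B.
Reversibility makes D symmetric and similar to P through diag(√π), so eigenvectors of D² are
eigenvectors of P². Aperiodicity reserves the eigenvalue 1 for the direction √π, and every other
singular value is at most cos(Δ/2) by the definition of Δ. The carriers are
`norm_sq_discriminant_le`, `sub_starProjection_norm_sq_ge` and `norm_sub_walk_ge`.

Circuit. No Fourier transform is needed. A probe of a fresh qubit (Hadamard, t controlled calls,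
Hadamard) turns the amplitude φ of the zero state into (φ + Uᵗφ)/2. Probes with t = 1, 2, …, 2^(s−1)
compose to the average M of the powers Uⁱ, i < 2^s. Telescoping gives (1 − U)M = 2^(−s)(1 −
U^(2^s)), so a gap g with g·2^s ≥ 4 forces ‖Mψ‖ ≤ ‖ψ‖/2, and m fresh blocks give 2^(−m). Let F be
the product of these probes and Z the sign change of every state in which some control is one. Then
F⁻¹ZF + 1 = F⁻¹(Z + 1)F, and Z + 1 keeps only the zero amplitude, so the error is exactly 2‖Mᵐψ‖
(`norm_phaseFlip_add`). Probes do nothing to a vector fixed by U, hence nothing to |π⟩.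

Resources. Z is a single rotation between two Toffoli chains and uses ms + 1 work qubits besides the
ms controls. With m = (k − 1)/2 rounded down these fit into ks qubits, and idle pairs of Hadamard
gates complete the count 2ks. For k = 1, 2 there is no room for Z, but one block of probes already
makes ψ|0⟩ and its image overlap by at most ‖ψ‖²/2, which suffices for a small c.

Uniformity is shown for an explicit program, by specifications `Prog.Runs` that also bound the steps
by a constant times N to the loop depth, where N bounds every loop count. -/

noncomputable section

namespace QWalk

/-! ### Two subspaces: angles, projections and products of reflections. -/

section Spectral

variable {𝕜 E : Type*} [RCLike 𝕜] [NormedAddCommGroup E] [InnerProductSpace 𝕜 E]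
  [FiniteDimensional 𝕜 E]

/-- A lower bound on the eigenvalues of a symmetric operator whose eigenvectors lie in an
invariant subspace bounds the quadratic form on that subspace. -/
theorem le_re_inner_of_eigenvalue_bound {T : E →ₗ[𝕜] E} (hT : T.IsSymmetric)
    {K : Submodule 𝕜 E} (hK : ∀ x ∈ K, T x ∈ K) {c : ℝ}
    (h : ∀ x ∈ K, x ≠ 0 → ∀ μ : ℝ, T x = (μ : 𝕜) • x → c ≤ μ) {x : E} (hx : x ∈ K) :
    c * ‖x‖ ^ 2 ≤ RCLike.re (inner 𝕜 x (T x)) := by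
  have hT' := hT.restrict_invariant hK
  set T' := T.restrict hK with hT'def
  let b := hT'.eigenvectorBasis rfl
  let μ := hT'.eigenvalues rfl
  have hb (i) : T' (b i) = (μ i : 𝕜) • b i := hT'.apply_eigenvectorBasis rfl i
  have hμ (i) : c ≤ μ i := by
    refine h (b i) (b i).2 ?_ (μ i) ?_
    · simpa using b.toBasis.ne_zero i
    · simpa [hT'def] using congrArg Subtype.val (hb i)
  let y : K := ⟨x, hx⟩
  have h1 : inner 𝕜 x (T x) = inner 𝕜 y (T' y) := rfl
  have h2 : ‖x‖ ^ 2 = ∑ i, ‖inner 𝕜 (b i) y‖ ^ 2 := by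
    rw [b.sum_sq_norm_inner_right]; rfl
  rw [h1, h2, ← b.sum_inner_mul_inner, map_sum, Finset.mul_sum]
  refine Finset.sum_le_sum fun i _ => ?_
  rw [← hT' (b i) y, hb, inner_smul_left, ← inner_conj_symm y (b i), RCLike.conj_ofReal]
  rw [mul_left_comm, RCLike.conj_mul, ← RCLike.ofReal_pow, ← RCLike.ofReal_mul, RCLike.ofReal_re]
  exact mul_le_mul_of_nonneg_right (hμ i) (by positivity)

/-- If two subspaces make a small angle on the complement of a common vector `p` only as far as
`c` allows, then the difference of the projections is bounded below on their sum. -/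
theorem sub_starProjection_norm_sq_ge {A B : Submodule 𝕜 E} {p : E} (hpA : p ∈ A) (hpB : p ∈ B)
    {c : ℝ}
    (hAB : ∀ a ∈ A, inner 𝕜 p a = 0 → ‖B.starProjection a‖ ^ 2 ≤ c ^ 2 * ‖a‖ ^ 2)
    (hBA : ∀ b ∈ B, inner 𝕜 p b = 0 → ‖A.starProjection b‖ ^ 2 ≤ c ^ 2 * ‖b‖ ^ 2)
    {x : E} (hx : x ∈ A ⊔ B) (hpx : inner 𝕜 p x = 0) :
    (1 - c ^ 2) * ‖x‖ ^ 2 ≤ ‖A.starProjection x - B.starProjection x‖ ^ 2 := by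
  have symA (u v : E) : inner 𝕜 (A.starProjection u) v = inner 𝕜 u (A.starProjection v) :=
    A.starProjection_isSymmetric u v
  have symB (u v : E) : inner 𝕜 (B.starProjection u) v = inner 𝕜 u (B.starProjection v) :=
    B.starProjection_isSymmetric u v
  have pA : A.starProjection p = p := A.starProjection_eq_self_iff.2 hpA
  have pB : B.starProjection p = p := B.starProjection_eq_self_iff.2 hpB
  have idA (u : E) : A.starProjection (A.starProjection u) = A.starProjection u :=
    A.starProjection_eq_self_iff.2 (A.starProjection_apply_mem u)
  have idB (u : E) : B.starProjection (B.starProjection u) = B.starProjection u :=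
    B.starProjection_eq_self_iff.2 (B.starProjection_apply_mem u)
  let S : E →ₗ[𝕜] E := (A.starProjection - B.starProjection : E →L[𝕜] E)
  have hS (u : E) : S u = A.starProjection u - B.starProjection u := rfl
  have symS : S.IsSymmetric := fun u v => by
    simp only [hS, inner_sub_left, inner_sub_right, symA, symB]
  let K : Submodule 𝕜 E := (A ⊔ B) ⊓ (𝕜 ∙ p)ᗮ
  have hKS : ∀ u ∈ K, S u ∈ K := by
    intro u hu
    refine ⟨?_, ?_⟩
    · exact sub_mem (Submodule.mem_sup_left (A.starProjection_apply_mem u))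
        (Submodule.mem_sup_right (B.starProjection_apply_mem u))
    · refine Submodule.mem_orthogonal_singleton_iff_inner_right.2 ?_
      rw [← symS, hS, pA, pB]
      simp
  -- The quadratic form of S² at x is ‖Sx‖², so it is enough to bound the eigenvalues of S² on K,
  -- which is S-invariant because S is symmetric and annihilates p.
  have key := le_re_inner_of_eigenvalue_bound (T := S ∘ₗ S) (K := K) (c := 1 - c ^ 2)
    (fun u v => by simp only [LinearMap.comp_apply, symS _ _])
    (fun u hu => hKS _ (hKS _ hu)) ?_ (x := x)
    ⟨hx, Submodule.mem_orthogonal_singleton_iff_inner_right.2 hpx⟩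
  · refine key.trans (le_of_eq ?_)
    rw [LinearMap.comp_apply, ← symS, inner_self_eq_norm_sq, hS]
  · rintro u ⟨huAB, hup⟩ hu0 μ hμ
    replace hup := Submodule.mem_orthogonal_singleton_iff_inner_right.1 hup
    simp only [LinearMap.comp_apply, hS, map_sub, idA, idB] at hμ
    -- With a = Π_A u, pairing the projected eigenvalue equation with a gives ‖a‖² − ‖Π_B a‖² =
    -- μ‖a‖². If a = 0, then B takes the role of A; both projections cannot vanish, since u is a
    -- nonzero vector of A + B.
    by_cases ha : A.starProjection u = 0
    · by_cases hb : B.starProjection u = 0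
      · exfalso
        apply hu0
        have h1 : u ∈ Aᗮ := by rwa [← A.starProjection_apply_eq_zero_iff]
        have h2 : u ∈ Bᗮ := by rwa [← B.starProjection_apply_eq_zero_iff]
        have h3 : u ∈ (A ⊔ B)ᗮ := by rw [← Submodule.inf_orthogonal]; exact ⟨h1, h2⟩
        exact inner_self_eq_zero.1 (h3 u huAB)
      · have h1 := congrArg (fun v => RCLike.re (inner 𝕜 (B.starProjection u) (B.starProjection v)))
          hμ
        simp only [map_sub, map_smul, inner_sub_right, inner_smul_right, ha, map_zero,
          zero_sub] at h1
        have h2 := hBA (B.starProjection u) (B.starProjection_apply_mem u) (by rw [← symB, pB, hup])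
        have h3 : inner 𝕜 (B.starProjection u)
              (B.starProjection (A.starProjection (B.starProjection u))) =
            inner 𝕜 (A.starProjection (B.starProjection u))
              (A.starProjection (B.starProjection u)) := by
          rw [← symB, idB, symA, idA]
        simp only [map_neg, inner_neg_right, h3, RCLike.re_ofReal_mul, idB,
          inner_self_eq_norm_sq] at h1
        have h4 : 0 < ‖B.starProjection u‖ ^ 2 := by positivity
        nlinarith
    · have h1 := congrArg (fun v => RCLike.re (inner 𝕜 (A.starProjection u) (A.starProjection v)))
          hμ
      have h2 := hAB (A.starProjection u) (A.starProjection_apply_mem u) (by rw [← symA, pA, hup])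
      have h3 : inner 𝕜 (A.starProjection u)
            (A.starProjection (B.starProjection (A.starProjection u))) =
          inner 𝕜 (B.starProjection (A.starProjection u))
            (B.starProjection (A.starProjection u)) := by
        rw [← symA, idA, symB, idB]
      simp only [map_sub, idA, map_smul, inner_sub_right, inner_smul_right, h3,
        RCLike.re_ofReal_mul, inner_self_eq_norm_sq] at h1
      have h4 : 0 < ‖A.starProjection u‖ ^ 2 := by positivity
      nlinarith

/-- The displacement under a product of two reflections. -/
theorem norm_sub_reflection_reflection (A B : Submodule 𝕜 E) (x : E) :
    ‖x - B.reflection (A.reflection x)‖ = 2 * ‖A.starProjection x - B.starProjection x‖ := by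
  have h : x - B.reflection (A.reflection x) = B.reflection (B.reflection x - A.reflection x) := by
    rw [map_sub, Submodule.reflection_reflection]
  rw [h, LinearIsometryEquiv.norm_map, Submodule.reflection_apply, Submodule.reflection_apply,
    sub_sub_sub_cancel_right, ← smul_sub, norm_sub_rev, ← Nat.cast_smul_eq_nsmul 𝕜, norm_smul,
    norm_sub_rev]
  simp

end Spectral

/-! ### Spectrum of the discriminant of an ergodic reversible chain. -/

section Reversible

variable {X : Type*} [Fintype X] [DecidableEq X] {P : Matrix X X ℝ} {π : X → ℝ}

omit [Fintype X] [DecidableEq X] in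
theorem IsReversible.apply_eq (hR : IsReversible P π) (x y : X) : P y x = π x * P x y / π y :=
  (congrFun (congrFun hR y) x).symm

/-- At a zero of π the time reversal divides by zero and takes the value 0, so reversibility would
make a whole row of P vanish. -/
theorem IsStationary.pos (hπ : IsStationary P π) (hP : IsErgodic P) (hR : IsReversible P π)
    (x : X) : 0 < π x := by
  refine (hπ.nonneg x).lt_of_ne' fun h => ?_
  have h1 := Matrix.sum_row_of_mem_rowStochastic hP.stochastic x
  have h2 (y : X) : P x y = 0 := by rw [hR.apply_eq y x, h, div_zero]
  simp [h2] at h1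

omit [Fintype X] [DecidableEq X] in
theorem IsReversible.detailed_balance (hR : IsReversible P π) (hpos : ∀ x, 0 < π x) (x y : X) :
    π y * P y x = π x * P x y := by
  rw [hR.apply_eq x y, mul_div_cancel₀ _ (hpos y).ne']

omit [Fintype X] [DecidableEq X] in
theorem IsReversible.discriminant_apply (hR : IsReversible P π) (x y : X) :
    discriminant P π x y = √(P x y * P y x) := by
  simp only [discriminant, Matrix.of_apply]
  rw [show timeReversal P π = P from hR]

omit [Fintype X] [DecidableEq X] in
theorem IsReversible.discriminant_symm (hR : IsReversible P π) (x y : X) :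
    discriminant P π x y = discriminant P π y x := by
  rw [hR.discriminant_apply, hR.discriminant_apply, mul_comm]

/-- Detailed balance makes p_xy p_yx π_y equal to π_x p_xy². This is the similarity between the
discriminant and P, written without inverses. -/
theorem IsReversible.discriminant_mul_sqrt (hR : IsReversible P π) (hP : IsErgodic P)
    (hpos : ∀ x, 0 < π x) (x y : X) :
    discriminant P π x y * √(π y) = √(π x) * P x y := by
  have h0 := hP.irreducible.nonneg
  rw [hR.discriminant_apply, ← Real.sqrt_mul (mul_nonneg (h0 _ _) (h0 _ _)), mul_assoc,
    mul_comm (P y x), hR.detailed_balance hpos, mul_left_comm, Real.sqrt_mul (hpos x).le,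
    Real.sqrt_mul_self (h0 _ _)]

/-- Over any two states there is a path of even length. -/
theorem IsErgodic.exists_even_pow_pos (hP : IsErgodic P) (x y : X) :
    ∃ m : ℕ, 0 < ((P * P) ^ m) x y := by
  have h0 := hP.irreducible.nonneg
  have hpow : ∀ (t : ℕ) (x y : X), 0 ≤ (P ^ t) x y := fun t x y =>
    Matrix.nonneg_of_mem_rowStochastic (pow_mem hP.stochastic t)
  obtain ⟨t, -, ht⟩ := (Matrix.isIrreducible_iff_exists_pow_pos h0).1 hP.irreducible x y
  -- If all return times were even, aperiodicity applied to the divisor 2 would give 2 = 1. An odd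
  -- loop at x then corrects the parity of any path from x.
  obtain ⟨r, hr, hodd⟩ : ∃ r, 0 < (P ^ r) x x ∧ ¬ 2 ∣ r := by
    by_contra! h
    have := hP.aperiodic x 2 fun t _ ht => h t ht
    omega
  have hrt : 0 < (P ^ (r + t)) x y := by
    rw [pow_add, Matrix.mul_apply]
    exact Finset.sum_pos' (fun z _ => mul_nonneg (hpow _ _ _) (hpow _ _ _))
      ⟨x, Finset.mem_univ _, mul_pos hr ht⟩
  rcases Nat.even_or_odd' t with ⟨m, rfl | rfl⟩
  · exact ⟨m, by rwa [← sq, ← pow_mul]⟩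
  · refine ⟨(r + (2 * m + 1)) / 2, ?_⟩
    rwa [← sq, ← pow_mul, show 2 * ((r + (2 * m + 1)) / 2) = r + (2 * m + 1) by omega]

/-- Maximum principle: at a maximum z of v, an average of the nonnegative numbers v z − v w is zero,
and some power of P² gives positive weight to any prescribed w. Using P² rather than P also rules
out the eigenvalue −1 of P. -/
theorem IsErgodic.eq_of_mulVec_mulVec_eq (hP : IsErgodic P) {v : X → ℝ}
    (hv : (P * P) *ᵥ v = v) (x y : X) : v x = v y := by
  have : Nonempty X := ⟨x⟩
  obtain ⟨z, hz⟩ := Finite.exists_max v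
  suffices h : ∀ y, v y = v z from (h x).trans (h y).symm
  intro y
  obtain ⟨m, hm⟩ := hP.exists_even_pow_pos z y
  have hst := pow_mem (mul_mem hP.stochastic hP.stochastic) m
  have hvm : ∀ m, ((P * P) ^ m) *ᵥ v = v := by
    intro m
    induction m with
    | zero => simp
    | succ m ih => rw [pow_succ, ← Matrix.mulVec_mulVec, hv, ih]
  have h1 : ∑ w, ((P * P) ^ m) z w * (v z - v w) = 0 := by
    simp only [mul_sub, Finset.sum_sub_distrib, ← Finset.sum_mul,
      Matrix.sum_row_of_mem_rowStochastic hst, one_mul]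
    rw [sub_eq_zero]
    exact (congrFun (hvm m) z).symm
  rw [Finset.sum_eq_zero_iff_of_nonneg fun w _ =>
    mul_nonneg (Matrix.nonneg_of_mem_rowStochastic hst) (sub_nonneg.2 (hz w))] at h1
  have h2 := (mul_eq_zero.1 (h1 y (Finset.mem_univ _))).resolve_left hm.ne'
  linarith

/-- Evaluate the eigenvalue equation where |v| is largest; an average cannot exceed the maximum. -/
theorem eigenvalue_le_one_of_mem_rowStochastic {Q : Matrix X X ℝ}
    (hQ : Q ∈ Matrix.rowStochastic ℝ X) {v : X → ℝ} {μ : ℝ} (hv : Q *ᵥ v = μ • v) (hv0 : v ≠ 0) :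
    μ ≤ 1 := by
  obtain ⟨x, hx⟩ := Function.ne_iff.1 hv0
  have : Nonempty X := ⟨x⟩
  obtain ⟨z, hz⟩ := Finite.exists_max fun x => |v x|
  have hz0 : 0 < |v z| := (abs_pos.2 hx).trans_le (hz x)
  have h1 : μ * |v z| ≤ 1 * |v z| :=
    calc μ * |v z| ≤ |μ * v z| := by rw [abs_mul]; gcongr; exact le_abs_self μ
      _ = |∑ w, Q z w * v w| := by
        rw [← smul_eq_mul, ← Pi.smul_apply, ← hv]; rfl
      _ ≤ ∑ w, |Q z w * v w| := Finset.abs_sum_le_sum_abs _ _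
      _ ≤ ∑ w, Q z w * |v z| := by
        refine Finset.sum_le_sum fun w _ => ?_
        rw [abs_mul, abs_of_nonneg (Matrix.nonneg_of_mem_rowStochastic hQ)]
        exact mul_le_mul_of_nonneg_left (hz w) (Matrix.nonneg_of_mem_rowStochastic hQ)
      _ = 1 * |v z| := by
        rw [← Finset.sum_mul, Matrix.sum_row_of_mem_rowStochastic hQ]
  exact le_of_mul_le_mul_right h1 hz0

/-- Each admissible θ is the arccosine of one of finitely many singular values. Finiteness makes the
infimum in `phaseGap` attained, hence positive. -/
theorem phaseGap_set_finite (P : Matrix X X ℝ) (π : X → ℝ) :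
    (insert Real.pi {δ : ℝ | ∃ θ ∈ Set.Ioo 0 (Real.pi / 2), δ = 2 * θ ∧
      ∃ i < Fintype.card X,
        (Matrix.toEuclideanLin (discriminant P π)).singularValues i = Real.cos θ}).Finite := by
  refine Set.Finite.insert _ (Set.Finite.subset ((Finset.range (Fintype.card X)).image fun i =>
    2 * Real.arccos ((Matrix.toEuclideanLin (discriminant P π)).singularValues i)).finite_toSet ?_)
  rintro δ ⟨θ, hθ, rfl, i, hi, h⟩
  simp only [Finset.coe_image, Set.mem_image, Finset.coe_range, Set.mem_Iio]
  refine ⟨i, hi, ?_⟩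
  rw [h, Real.arccos_cos hθ.1.le (by linarith [hθ.2, Real.pi_pos])]

theorem phaseGap_le_pi (P : Matrix X X ℝ) (π : X → ℝ) : phaseGap P π ≤ Real.pi :=
  csInf_le (phaseGap_set_finite P π).bddBelow (Set.mem_insert _ _)

theorem phaseGap_pos (P : Matrix X X ℝ) (π : X → ℝ) : 0 < phaseGap P π := by
  have h := Set.Nonempty.csInf_mem (Set.insert_nonempty _ _) (phaseGap_set_finite P π)
  change phaseGap P π ∈ _ at h
  rcases h with h | ⟨θ, hθ, h, -⟩
  · rw [h]; exact Real.pi_pos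
  · rw [h]; linarith [hθ.1]

/-- A singular value strictly between 0 and 1 is the cosine of an admissible angle. The value 0 is
covered by Δ/2 ≤ π/2, which is where the default value π of the gap enters. -/
theorem singularValue_le_cos_phaseGap {i : ℕ} (hi : i < Fintype.card X)
    (h1 : (Matrix.toEuclideanLin (discriminant P π)).singularValues i < 1) :
    (Matrix.toEuclideanLin (discriminant P π)).singularValues i ≤
      Real.cos (phaseGap P π / 2) := by
  have hle := phaseGap_le_pi P π
  have hpos := phaseGap_pos P π
  set σ := (Matrix.toEuclideanLin (discriminant P π)).singularValues i with hσ
  rcases (LinearMap.singularValues_nonneg (Matrix.toEuclideanLin (discriminant P π)) i).eq_or_lt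
    with h0 | h0
  · rw [hσ, ← h0]
    exact Real.cos_nonneg_of_mem_Icc ⟨by linarith, by linarith⟩
  · have hcos : Real.cos (Real.arccos σ) = σ := Real.cos_arccos (by linarith) h1.le
    have hmem : phaseGap P π ≤ 2 * Real.arccos σ := by
      refine csInf_le (phaseGap_set_finite P π).bddBelow (Set.mem_insert_of_mem _
        ⟨Real.arccos σ, ⟨Real.arccos_pos.2 h1, Real.arccos_lt_pi_div_two.2 h0⟩, rfl, i, hi, ?_⟩)
      rw [hcos]
    rw [← hcos]
    exact Real.cos_le_cos_of_nonneg_of_le_pi (by linarith) (Real.arccos_le_pi _) (by linarith)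

theorem toEuclideanLin_discriminant_isSymmetric (hR : IsReversible P π) :
    (Matrix.toEuclideanLin (discriminant P π)).IsSymmetric := by
  rw [Matrix.isSymmetric_toEuclideanLin_iff]
  ext x y
  simpa using hR.discriminant_symm y x

/-- On the complement of `√π` the discriminant is bounded by the cosine of half the phase gap. -/
theorem norm_sq_discriminant_le (hP : IsErgodic P) (hπ : IsStationary P π)
    (hR : IsReversible P π) {u : EuclideanSpace ℝ X} (hu : ∑ x, √(π x) * u x = 0) :
    ‖Matrix.toEuclideanLin (discriminant P π) u‖ ^ 2 ≤
      Real.cos (phaseGap P π / 2) ^ 2 * ‖u‖ ^ 2 := by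
  have hpos := hπ.pos hP hR
  set T := Matrix.toEuclideanLin (discriminant P π) with hT
  have hTapp (u : EuclideanSpace ℝ X) (x : X) : T u x = ∑ y, discriminant P π x y * u y := rfl
  have hTsym : T.IsSymmetric := toEuclideanLin_discriminant_isSymmetric hR
  have hadj : LinearMap.adjoint T = T := hTsym.adjoint_eq
  let p : EuclideanSpace ℝ X := WithLp.toLp 2 fun x => √(π x)
  have hp (u : EuclideanSpace ℝ X) : inner ℝ p u = ∑ x, √(π x) * u x := by
    simp [p, PiLp.inner_apply, mul_comm]
  have hconj (v : X → ℝ) (x : X) :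
      T (WithLp.toLp 2 fun x => √(π x) * v x) x = √(π x) * (P *ᵥ v) x := by
    rw [hTapp, Matrix.mulVec, dotProduct, Finset.mul_sum]
    refine Finset.sum_congr rfl fun y _ => ?_
    rw [← mul_assoc, ← mul_assoc]
    exact congrArg (· * v y) (hR.discriminant_mul_sqrt hP hpos x y)
  have hTp : T p = p := by
    ext x
    have h1 := hconj 1 x
    rw [hP.stochastic.2] at h1
    simpa [p] using h1
  -- The spectral lemma gives lower bounds, so it is applied to −T² on the complement of √π.
  have key := le_re_inner_of_eigenvalue_bound (T := -(T ∘ₗ T)) (K := (ℝ ∙ p)ᗮ)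
    (c := -Real.cos (phaseGap P π / 2) ^ 2) (x := u) ?_ ?_ ?_
    (Submodule.mem_orthogonal_singleton_iff_inner_right.2 ((hp u).trans hu))
  · simp only [LinearMap.neg_apply, LinearMap.comp_apply, inner_neg_right, ← hTsym u,
      RCLike.re_to_real, real_inner_self_eq_norm_sq] at key
    linarith
  · intro u v
    simp only [LinearMap.neg_apply, LinearMap.comp_apply, inner_neg_right, inner_neg_left,
      hTsym _ _]
  · intro w hw
    replace hw := Submodule.mem_orthogonal_singleton_iff_inner_right.1 hw
    refine Submodule.mem_orthogonal_singleton_iff_inner_right.2 ?_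
    simp only [LinearMap.neg_apply, LinearMap.comp_apply, inner_neg_right]
    rw [← hTsym, ← hTsym, hTp, hTp, hw, neg_zero]
  · intro w hw hw0 μ hμ
    replace hw := Submodule.mem_orthogonal_singleton_iff_inner_right.1 hw
    rw [hp] at hw
    have hμ' : T (T w) = (-μ) • w := by
      rw [neg_smul]
      exact neg_eq_iff_eq_neg.1 hμ
    have hev : Module.End.HasEigenvalue (LinearMap.adjoint T ∘ₗ T) (-μ) := by
      refine Module.End.hasEigenvalue_of_hasEigenvector (x := w)
        ⟨Module.End.mem_eigenspace_iff.2 ?_, hw0⟩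
      rw [hadj]; exact hμ'
    obtain ⟨i, hi⟩ := T.isSymmetric_adjoint_comp_self.exists_eigenvalues_eq
      (finrank_euclideanSpace (𝕜 := ℝ) (ι := X)) hev
    have hsq := T.sq_singularValues_fin (finrank_euclideanSpace (𝕜 := ℝ) (ι := X)) i
    rw [show T.isSymmetric_adjoint_comp_self.eigenvalues _ i = -μ from hi] at hsq
    -- Dividing by √π turns the eigenvector w of T² into an eigenvector of P².
    let v : X → ℝ := fun x => w x / √(π x)
    have hsp (x : X) : 0 < √(π x) := Real.sqrt_pos.2 (hpos x)
    have hwv : w = WithLp.toLp 2 fun x => √(π x) * v x := by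
      ext x; simp only [v]; rw [mul_div_cancel₀ _ (hsp x).ne']
    have hPv : (P * P) *ᵥ v = (-μ) • v := by
      rw [← Matrix.mulVec_mulVec]
      ext x
      have h1 : T w = WithLp.toLp 2 fun x => √(π x) * (P *ᵥ v) x := by
        ext x; rw [hwv]; exact hconj v x
      have h2 := congrArg (fun z : EuclideanSpace ℝ X => z x) hμ'
      simp only [h1] at h2
      rw [hconj, hwv] at h2
      simp only [PiLp.smul_apply, smul_eq_mul] at h2
      rw [Pi.smul_apply, smul_eq_mul]
      refine mul_left_cancel₀ (hsp x).ne' ?_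
      rw [h2]; ring
    have hv0 : v ≠ 0 := by
      intro h
      apply hw0
      rw [hwv, h]
      ext x; simp
    have hle1 : -μ ≤ 1 :=
      eigenvalue_le_one_of_mem_rowStochastic (mul_mem hP.stochastic hP.stochastic) hPv hv0
    -- For the eigenvalue 1 the vector v is constant, so w is a multiple of √π, and orthogonality to
    -- √π forces it to vanish.
    have hne1 : -μ ≠ 1 := by
      intro h1
      rw [h1, one_smul] at hPv
      obtain ⟨x, hx⟩ := Function.ne_iff.1 hv0
      have hc (y : X) : v y = v x := hP.eq_of_mulVec_mulVec_eq hPv y x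
      have h2 : ∑ y, √(π y) * w y = v x * ∑ y, π y := by
        rw [Finset.mul_sum]
        refine Finset.sum_congr rfl fun y _ => ?_
        rw [hwv, ← hc y]
        simp only
        rw [← mul_assoc, Real.mul_self_sqrt (hpos y).le, mul_comm]
      rw [hw, hπ.sum_eq_one, mul_one] at h2
      exact hx h2.symm
    have hlt : T.singularValues i < 1 := by
      have h0 := T.singularValues_nonneg i
      have : T.singularValues i ^ 2 < 1 := by rw [hsq]; exact lt_of_le_of_ne hle1 hne1
      nlinarith
    have h3 := singularValue_le_cos_phaseGap (P := P) (π := π) i.2 hlt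
    have h4 : T.singularValues i ^ 2 ≤ Real.cos (phaseGap P π / 2) ^ 2 :=
      pow_le_pow_left₀ (T.singularValues_nonneg i) h3 2
    linarith

end Reversible

/-! ### The spaces A and B, and the gap of the walk on their sum. -/

section Walk

/-- Since M and r are real, the real and imaginary parts of u satisfy the constraint separately and
their bounds add up. -/
theorem sum_norm_sq_mulVec_le {X : Type*} [Fintype X] [DecidableEq X] {M : Matrix X X ℝ}
    {r : X → ℝ} {c : ℝ}
    (hc : ∀ u : EuclideanSpace ℝ X, ∑ x, r x * u x = 0 →
      ‖Matrix.toEuclideanLin M u‖ ^ 2 ≤ c ^ 2 * ‖u‖ ^ 2)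
    {u : X → ℂ} (hu : ∑ x, (r x : ℂ) * u x = 0) :
    ∑ y, ‖∑ x, (M y x : ℂ) * u x‖ ^ 2 ≤ c ^ 2 * ∑ x, ‖u x‖ ^ 2 := by
  have hre := hc (WithLp.toLp 2 fun x => (u x).re) (by simpa using congrArg Complex.re hu)
  have him := hc (WithLp.toLp 2 fun x => (u x).im) (by simpa using congrArg Complex.im hu)
  rw [EuclideanSpace.norm_sq_eq, EuclideanSpace.norm_sq_eq] at hre him
  simp only [Matrix.toLpLin_apply, Matrix.mulVec, dotProduct, Real.norm_eq_abs, sq_abs] at hre him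
  simp only [Complex.sq_norm, Complex.normSq_apply, Complex.re_sum, Complex.im_sum,
    Complex.re_ofReal_mul, Complex.im_ofReal_mul, ← sq, Finset.sum_add_distrib, mul_add]
  exact add_le_add hre him

theorem norm_sq_sum_smul_of_orthonormal {X E : Type*} [Fintype X] [NormedAddCommGroup E]
    [InnerProductSpace ℂ E] {e : X → E} (he : Orthonormal ℂ e) (u : X → ℂ) :
    ‖∑ x, u x • e x‖ ^ 2 = ∑ x, ‖u x‖ ^ 2 := by
  have h := he.inner_sum u u Finset.univ
  rw [inner_self_eq_norm_sq_to_K] at h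
  simp only [RCLike.conj_mul] at h
  exact_mod_cast h

/-- The projection between the spans of two orthonormal families, in terms of the matrix of their
inner products. -/
theorem norm_sq_starProjection_span_le {X E : Type*} [Fintype X] [DecidableEq X]
    [NormedAddCommGroup E] [InnerProductSpace ℂ E] [FiniteDimensional ℂ E] {e f : X → E}
    (he : Orthonormal ℂ e) (hf : Orthonormal ℂ f) {M : Matrix X X ℝ}
    (hM : ∀ y x, inner ℂ (f y) (e x) = (M y x : ℂ)) {r : X → ℝ} {c : ℝ}
    (hc : ∀ u : EuclideanSpace ℝ X, ∑ x, r x * u x = 0 →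
      ‖Matrix.toEuclideanLin M u‖ ^ 2 ≤ c ^ 2 * ‖u‖ ^ 2) {a : E}
    (ha : a ∈ Submodule.span ℂ (Set.range e)) (hra : inner ℂ (∑ x, (r x : ℂ) • e x) a = 0) :
    ‖(Submodule.span ℂ (Set.range f)).starProjection a‖ ^ 2 ≤ c ^ 2 * ‖a‖ ^ 2 := by
  obtain ⟨u, rfl⟩ := (Submodule.mem_span_range_iff_exists_fun ℂ).1 ha
  set v := (Submodule.span ℂ (Set.range f)).starProjection (∑ x, u x • e x) with hv
  have hvf : v ∈ Submodule.span ℂ (Set.range f) := Submodule.starProjection_apply_mem _ _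
  -- For the projection v of a, ‖v‖² = ⟨v, a⟩. In coordinates this is the inner product of w with z
  -- = Mu, and Cauchy–Schwarz gives ‖v‖ ≤ ‖z‖.
  have hself : inner ℂ v v = inner ℂ v (∑ x, u x • e x) := by
    have h2 : (Submodule.span ℂ (Set.range f)).starProjection v = v :=
      Submodule.starProjection_eq_self_iff.2 hvf
    rw [← Submodule.inner_starProjection_left_eq_right, h2, hv]
  obtain ⟨w, hw⟩ := (Submodule.mem_span_range_iff_exists_fun ℂ).1 hvf
  have hu : ∑ x, (r x : ℂ) * u x = 0 := by
    rw [he.inner_sum] at hra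
    simpa using hra
  have hbound := sum_norm_sq_mulVec_le hc hu
  let w' : EuclideanSpace ℂ X := WithLp.toLp 2 w
  let z : EuclideanSpace ℂ X := WithLp.toLp 2 fun y => ∑ x, (M y x : ℂ) * u x
  have hwz : inner ℂ v (∑ x, u x • e x) = inner ℂ w' z := by
    rw [← hw, sum_inner, PiLp.inner_apply]
    refine Finset.sum_congr rfl fun y _ => ?_
    rw [inner_smul_left, inner_sum]
    simp only [inner_smul_right, hM, w', z, RCLike.inner_apply]
    rw [mul_comm]
    congr 1
    exact Finset.sum_congr rfl fun x _ => mul_comm _ _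
  have hw' : ‖w'‖ = ‖v‖ := by
    rw [← sq_eq_sq₀ (norm_nonneg _) (norm_nonneg _), ← hw, norm_sq_sum_smul_of_orthonormal hf,
      EuclideanSpace.norm_sq_eq]
  have hz : ‖z‖ ^ 2 ≤ c ^ 2 * ‖∑ x, u x • e x‖ ^ 2 := by
    rw [norm_sq_sum_smul_of_orthonormal he, EuclideanSpace.norm_sq_eq]
    exact hbound
  have h1 : ‖v‖ * ‖v‖ ≤ ‖v‖ * ‖z‖ := by
    have := norm_inner_le_norm (𝕜 := ℂ) w' z
    rw [← hwz, ← hself, hw', inner_self_eq_norm_sq_to_K] at this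
    simpa [sq] using this
  have h2 : ‖v‖ ≤ ‖z‖ := by
    rcases (norm_nonneg v).eq_or_lt with h | h
    · rw [← h]; exact norm_nonneg _
    · exact le_of_mul_le_mul_left h1 h
  exact (pow_le_pow_left₀ (norm_nonneg _) h2 2).trans hz

variable {X : Type*} [Fintype X] [DecidableEq X] {P : Matrix X X ℝ} {π : X → ℝ}

theorem inner_inVec_outVec (P : Matrix X X ℝ) (π : X → ℝ) (x y : X) :
    inner ℂ (inVec P π y) (outVec P x) = (√(timeReversal P π y x) * √(P x y) : ℝ) := by
  simp only [PiLp.inner_apply, inVec, outVec, RCLike.inner_apply, Fintype.sum_prod_type]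
  rw [Finset.sum_eq_single x, Finset.sum_eq_single y]
  · simp [mul_comm]
  · intro b _ hb; simp [hb]
  · simp
  · intro b _ hb; simp [hb]
  · simp

theorem orthonormal_outVec (hP : P ∈ Matrix.rowStochastic ℝ X) : Orthonormal ℂ (outVec P) := by
  rw [orthonormal_iff_ite]
  intro x y
  simp only [PiLp.inner_apply, outVec, RCLike.inner_apply, Fintype.sum_prod_type]
  split_ifs with h
  · subst h
    rw [Finset.sum_eq_single x]
    · simp only [if_true, Complex.conj_ofReal]
      norm_cast
      simp only [Real.mul_self_sqrt (Matrix.nonneg_of_mem_rowStochastic hP)]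
      exact Matrix.sum_row_of_mem_rowStochastic hP x
    · intro b _ hb; simp [hb]
    · simp
  · refine Finset.sum_eq_zero fun z _ => Finset.sum_eq_zero fun w _ => ?_
    by_cases hz : z = x
    · have : z ≠ y := fun h' => h (hz.symm.trans h')
      simp [this]
    · simp [hz]

theorem orthonormal_inVec (hP : timeReversal P π ∈ Matrix.rowStochastic ℝ X) :
    Orthonormal ℂ (inVec P π) := by
  rw [orthonormal_iff_ite]
  intro x y
  simp only [PiLp.inner_apply, inVec, RCLike.inner_apply, Fintype.sum_prod_type]
  rw [Finset.sum_comm]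
  split_ifs with h
  · subst h
    rw [Finset.sum_eq_single x]
    · simp only [if_true, Complex.conj_ofReal]
      norm_cast
      simp only [Real.mul_self_sqrt (Matrix.nonneg_of_mem_rowStochastic hP)]
      exact Matrix.sum_row_of_mem_rowStochastic hP x
    · intro b _ hb; simp [hb]
    · simp
  · refine Finset.sum_eq_zero fun z _ => Finset.sum_eq_zero fun w _ => ?_
    by_cases hz : z = x
    · have : z ≠ y := fun h' => h (hz.symm.trans h')
      simp [this]
    · simp [hz]

/-- The coefficient of |x⟩|y⟩ is √(π_x p_xy), which detailed balance makes symmetric. This places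
|π⟩ in B as well as in A. -/
theorem stationaryState_eq_sum_inVec (hP : IsErgodic P) (hπ : IsStationary P π)
    (hR : IsReversible P π) :
    stationaryState P π = ∑ y, (√(π y) : ℂ) • inVec P π y := by
  have hpos := hπ.pos hP hR
  ext ⟨x, y⟩
  simp only [stationaryState, WithLp.ofLp_sum, Finset.sum_apply, PiLp.smul_apply, outVec, inVec,
    smul_eq_mul, mul_ite, mul_zero, Finset.sum_ite_eq, Finset.mem_univ, if_true]
  rw [show timeReversal P π = P from hR]
  norm_cast
  rw [← Real.sqrt_mul (hpos x).le, ← Real.sqrt_mul (hpos y).le, hR.detailed_balance hpos]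

theorem stationaryState_mem_spaceA (P : Matrix X X ℝ) (π : X → ℝ) :
    stationaryState P π ∈ spaceA P :=
  sum_mem fun x _ => Submodule.smul_mem _ _ (Submodule.subset_span ⟨x, rfl⟩)

theorem stationaryState_mem_spaceB (hP : IsErgodic P) (hπ : IsStationary P π)
    (hR : IsReversible P π) : stationaryState P π ∈ spaceB P π := by
  rw [stationaryState_eq_sum_inVec hP hπ hR]
  exact sum_mem fun x _ => Submodule.smul_mem _ _ (Submodule.subset_span ⟨x, rfl⟩)

theorem walk_apply (P : Matrix X X ℝ) (π : X → ℝ) (ψ : EuclideanSpace ℂ (X × X)) :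
    walk P π ψ = (spaceB P π).reflection ((spaceA P).reflection ψ) := rfl

theorem walk_stationaryState (hP : IsErgodic P) (hπ : IsStationary P π)
    (hR : IsReversible P π) : walk P π (stationaryState P π) = stationaryState P π := by
  rw [walk_apply, Submodule.reflection_mem_subspace_eq_self (stationaryState_mem_spaceA P π),
    Submodule.reflection_mem_subspace_eq_self (stationaryState_mem_spaceB hP hπ hR)]

/-- The part of `A + B` orthogonal to the stationary state. -/
def busySpace (P : Matrix X X ℝ) (π : X → ℝ) : Submodule ℂ (EuclideanSpace ℂ (X × X)) :=
  (spaceA P ⊔ spaceB P π) ⊓ (ℂ ∙ stationaryState P π)ᗮ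

theorem mem_busySpace {ψ : EuclideanSpace ℂ (X × X)} :
    ψ ∈ busySpace P π ↔
      ψ ∈ spaceA P ⊔ spaceB P π ∧ inner ℂ (stationaryState P π) ψ = 0 :=
  and_congr_right fun _ => Submodule.mem_orthogonal_singleton_iff_inner_right

/-- Both reflections preserve A + B, and the walk is unitary and fixes |π⟩, so orthogonality to |π⟩
persists. -/
theorem walk_mem_busySpace (hP : IsErgodic P) (hπ : IsStationary P π) (hR : IsReversible P π)
    {ψ : EuclideanSpace ℂ (X × X)} (hψ : ψ ∈ busySpace P π) : walk P π ψ ∈ busySpace P π := by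
  rw [mem_busySpace] at hψ ⊢
  refine ⟨?_, ?_⟩
  · have h1 : (spaceA P).reflection ψ ∈ spaceA P ⊔ spaceB P π := by
      rw [Submodule.reflection_apply]
      exact sub_mem (Submodule.smul_of_tower_mem _ 2 (Submodule.mem_sup_left
        (Submodule.starProjection_apply_mem _ _))) hψ.1
    rw [walk_apply, Submodule.reflection_apply]
    exact sub_mem (Submodule.smul_of_tower_mem _ 2 (Submodule.mem_sup_right
        (Submodule.starProjection_apply_mem _ _))) h1
  · rw [← hψ.2]
    conv_lhs => rw [← walk_stationaryState hP hπ hR]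
    exact LinearIsometryEquiv.inner_map_map _ _ _

/-- The walk moves every vector of `A + B` orthogonal to the stationary state by an amount
controlled by the phase gap. -/
theorem norm_sub_walk_ge (hP : IsErgodic P) (hπ : IsStationary P π) (hR : IsReversible P π)
    {ψ : EuclideanSpace ℂ (X × X)} (hψ : ψ ∈ busySpace P π) :
    2 * Real.sin (phaseGap P π / 2) * ‖ψ‖ ≤ ‖ψ - walk P π ψ‖ := by
  rw [mem_busySpace] at hψ
  have hout := orthonormal_outVec hP.stochastic
  have hin : Orthonormal ℂ (inVec P π) := orthonormal_inVec (by
    rw [show timeReversal P π = P from hR]; exact hP.stochastic)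
  have h0 := hP.irreducible.nonneg
  have hio (y x : X) : inner ℂ (inVec P π y) (outVec P x) = (discriminant P π y x : ℂ) := by
    rw [inner_inVec_outVec, hR.discriminant_apply, show timeReversal P π = P from hR,
      Real.sqrt_mul (h0 _ _)]
  have hoi (y x : X) : inner ℂ (outVec P y) (inVec P π x) = (discriminant P π y x : ℂ) := by
    rw [← inner_conj_symm, hio, Complex.conj_ofReal, hR.discriminant_symm]
  have hc (u : EuclideanSpace ℝ X) (hu : ∑ x, √(π x) * u x = 0) :=
    norm_sq_discriminant_le hP hπ hR hu
  have key := sub_starProjection_norm_sq_ge (stationaryState_mem_spaceA P π)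
    (stationaryState_mem_spaceB hP hπ hR) (c := Real.cos (phaseGap P π / 2))
    (fun a ha hpa => norm_sq_starProjection_span_le hout hin hio hc ha hpa)
    (fun b hb hpb => norm_sq_starProjection_span_le hin hout hoi hc hb (by
      rwa [stationaryState_eq_sum_inVec hP hπ hR] at hpb)) hψ.1 hψ.2
  rw [walk_apply, norm_sub_reflection_reflection, mul_assoc]
  refine mul_le_mul_of_nonneg_left ?_ zero_le_two
  have hs : 0 ≤ Real.sin (phaseGap P π / 2) :=
    Real.sin_nonneg_of_nonneg_of_le_pi (by linarith [phaseGap_pos P π])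
      (by linarith [phaseGap_le_pi P π, phaseGap_pos P π])
  refine le_of_sq_le_sq ?_ (norm_nonneg _)
  rw [mul_pow, Real.sin_sq]
  exact key

end Walk

/-! ### Gates as operations on amplitudes indexed by the basis states of the qubits. -/

section Slices

variable {V : Type*} {Q : Type} [DecidableEq Q] [Fintype V]
  (U : EuclideanSpace ℂ V ≃ₗᵢ[ℂ] EuclideanSpace ℂ V)

omit [DecidableEq Q] [Fintype V] in
theorem slice_ext {Ψ Φ : Joint V Q} (h : ∀ b, slice Ψ b = slice Φ b) : Ψ = Φ := by
  ext ⟨v, b⟩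
  exact congrArg (fun z : EuclideanSpace ℂ V => z v) (h b)

omit [DecidableEq Q] [Fintype V] in
@[simp] theorem slice_add (Ψ Φ : Joint V Q) (b : Q → Bool) :
    slice (Ψ + Φ) b = slice Ψ b + slice Φ b := rfl

omit [DecidableEq Q] [Fintype V] in
theorem slice_withZeros [Fintype Q] (ψ : EuclideanSpace ℂ V) (b : Q → Bool) :
    slice (withZeros ψ) b = if b = fun _ => false then ψ else 0 := by
  ext v
  by_cases h : b = fun _ => false <;> simp [slice, withZeros, h]

omit [DecidableEq Q] [Fintype V] in
@[simp] theorem slice_withZeros_zero [Fintype Q] (ψ : EuclideanSpace ℂ V) :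
    slice (withZeros ψ) (fun _ : Q => false) = ψ := by
  rw [slice_withZeros, if_pos rfl]

theorem slice_hadamard (i : Q) (Ψ : Joint V Q) (b : Q → Bool) :
    slice ((Gate.hadamard i).apply U Ψ) b = (√2 : ℂ)⁻¹ •
      (slice Ψ (Function.update b i false) +
        (if b i then (-1 : ℂ) else 1) • slice Ψ (Function.update b i true)) := by
  ext v
  simp only [slice, Gate.apply, PiLp.smul_apply, PiLp.add_apply, smul_eq_mul]
  rw [div_eq_inv_mul]

theorem slice_call (i : Q) (Ψ : Joint V Q) (b : Q → Bool) :
    slice ((Gate.call i).apply U Ψ) b = if b i then U (slice Ψ b) else slice Ψ b := by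
  ext v
  by_cases h : b i <;> simp [slice, Gate.apply, h]

theorem slice_callInv (i : Q) (Ψ : Joint V Q) (b : Q → Bool) :
    slice ((Gate.callInv i).apply U Ψ) b = if b i then U.symm (slice Ψ b) else slice Ψ b := by
  ext v
  by_cases h : b i <;> simp [slice, Gate.apply, h]

theorem slice_not (i : Q) (Ψ : Joint V Q) (b : Q → Bool) :
    slice ((Gate.not i).apply U Ψ) b = slice Ψ (Function.update b i (!(b i))) := rfl

theorem slice_toffoli (i j t : Q) (Ψ : Joint V Q) (b : Q → Bool) :
    slice ((Gate.toffoli i j t).apply U Ψ) b =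
      slice Ψ (Function.update b t (xor (b t) (b i && b j))) := rfl

/-- The rotation with parameter 1 has angle π, so it is a controlled sign. -/
theorem slice_cphase_one (i j : Q) (Ψ : Joint V Q) (b : Q → Bool) :
    slice ((Gate.cphase i j 1 false).apply U Ψ) b =
      (if b i && b j then (-1 : ℂ) else 1) • slice Ψ b := by
  ext v
  simp only [slice, Gate.apply, PiLp.smul_apply, smul_eq_mul]
  congr 2
  simp only [pow_one, Bool.false_eq_true, if_false, one_mul]
  rw [← Complex.exp_pi_mul_I]
  congr 1
  ring

theorem Gate.apply_add (g : Gate Q) (Ψ Φ : Joint V Q) :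
    g.apply U (Ψ + Φ) = g.apply U Ψ + g.apply U Φ := by
  cases g with
  | hadamard i => refine slice_ext fun b => ?_; simp only [slice_hadamard, slice_add]; module
  | call i =>
    refine slice_ext fun b => ?_; simp only [slice_call, slice_add]; split_ifs <;> simp
  | callInv i =>
    refine slice_ext fun b => ?_; simp only [slice_callInv, slice_add]; split_ifs <;> simp
  | cphase i j l inv =>
    ext w
    simp only [Gate.apply, PiLp.add_apply, mul_add]
  | not t => rfl
  | cnot i t => rfl
  | toffoli i j t => rfl

theorem norm_sq_eq_sum_slice [Fintype Q] (Ψ : Joint V Q) :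
    ‖Ψ‖ ^ 2 = ∑ b, ‖slice Ψ b‖ ^ 2 := by
  simp only [EuclideanSpace.norm_sq_eq, Fintype.sum_prod_type, slice]
  exact Finset.sum_comm

/-- Doubling the sum of squares pairs each basis state with its flip at i, and the parallelogram law
holds in each pair. -/
theorem norm_hadamard [Fintype Q] (i : Q) (Ψ : Joint V Q) :
    ‖(Gate.hadamard i).apply U Ψ‖ = ‖Ψ‖ := by
  rw [← sq_eq_sq₀ (norm_nonneg _) (norm_nonneg _), norm_sq_eq_sum_slice, norm_sq_eq_sum_slice]
  let flip : (Q → Bool) → (Q → Bool) := fun b => Function.update b i (!(b i))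
  have hflip : Function.Involutive flip := fun b => by
    simp [flip]
  have hsum (f : (Q → Bool) → ℝ) : 2 * ∑ b, f b = ∑ b, (f b + f (flip b)) := by
    rw [Finset.sum_add_distrib, two_mul]
    exact congrArg _ (Equiv.sum_comp hflip.toPerm f).symm
  refine mul_left_cancel₀ (two_ne_zero (α := ℝ)) ?_
  rw [hsum, hsum]
  refine Finset.sum_congr rfl fun b _ => ?_
  have h2 : ‖(√2 : ℂ)⁻¹‖ ^ 2 = 1 / 2 := by
    rw [norm_inv, Complex.norm_real, Real.norm_eq_abs, inv_pow, sq_abs]; norm_num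
  have hpar (x y : EuclideanSpace ℂ V) : ‖x + y‖ ^ 2 + ‖x - y‖ ^ 2 = 2 * (‖x‖ ^ 2 + ‖y‖ ^ 2) := by
    simpa [sq] using parallelogram_law_with_norm ℂ x y
  have hu (c : Bool) (h : b i = c) : Function.update b i c = b := by
    rw [← h]; exact Function.update_eq_self i b
  simp only [slice_hadamard, norm_smul, mul_pow, h2, flip, Function.update_idem,
    Function.update_self]
  cases h : b i
  · have := hpar (slice Ψ b) (slice Ψ (Function.update b i true))
    simp only [Bool.not_false, if_true, Bool.false_eq_true, if_false, one_smul, neg_smul, hu _ h,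
      ← sub_eq_add_neg]
    linarith
  · have := hpar (slice Ψ (Function.update b i false)) (slice Ψ b)
    simp only [Bool.not_true, if_true, Bool.false_eq_true, if_false, one_smul, neg_smul, hu _ h,
      ← sub_eq_add_neg]
    linarith

theorem norm_call [Fintype Q] (i : Q) (Ψ : Joint V Q) : ‖(Gate.call i).apply U Ψ‖ = ‖Ψ‖ := by
  rw [← sq_eq_sq₀ (norm_nonneg _) (norm_nonneg _), norm_sq_eq_sum_slice, norm_sq_eq_sum_slice]
  refine Finset.sum_congr rfl fun b _ => ?_
  rw [slice_call]; split_ifs <;> simp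

theorem norm_callInv [Fintype Q] (i : Q) (Ψ : Joint V Q) :
    ‖(Gate.callInv i).apply U Ψ‖ = ‖Ψ‖ := by
  rw [← sq_eq_sq₀ (norm_nonneg _) (norm_nonneg _), norm_sq_eq_sum_slice, norm_sq_eq_sum_slice]
  refine Finset.sum_congr rfl fun b _ => ?_
  rw [slice_callInv]; split_ifs <;> simp

theorem norm_withZeros [Fintype Q] (ψ : EuclideanSpace ℂ V) :
    ‖(withZeros ψ : Joint V Q)‖ = ‖ψ‖ := by
  rw [← sq_eq_sq₀ (norm_nonneg _) (norm_nonneg _), norm_sq_eq_sum_slice,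
    Finset.sum_eq_single fun _ => false, slice_withZeros_zero]
  · intro b _ hb
    simp [slice_withZeros, hb]
  · simp

theorem hadamard_hadamard (i : Q) (Ψ : Joint V Q) :
    (Gate.hadamard i).apply U ((Gate.hadamard i).apply U Ψ) = Ψ := by
  refine slice_ext fun b => ?_
  have h2 : (√2 : ℂ)⁻¹ * (√2 : ℂ)⁻¹ = 1 / 2 := by
    rw [← mul_inv]; norm_cast; rw [Real.mul_self_sqrt zero_le_two]; norm_num
  have hu (c : Bool) (h : b i = c) : Function.update b i c = b := by
    rw [← h]; exact Function.update_eq_self i b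
  simp only [slice_hadamard, Function.update_idem, Function.update_self]
  generalize (√2 : ℂ)⁻¹ = r at h2 ⊢
  cases h : b i <;> simp only [Bool.false_eq_true, if_false, if_true, hu _ h] <;>
    match_scalars <;> first | ring1 | linear_combination 2 * h2

theorem callInv_call (i : Q) (Ψ : Joint V Q) :
    (Gate.callInv i).apply U ((Gate.call i).apply U Ψ) = Ψ := by
  refine slice_ext fun b => ?_
  rw [slice_callInv, slice_call]; split_ifs <;> simp

end Slices

namespace Circuit

variable {V : Type*} {Q : Type} [DecidableEq Q] [Fintype V]
  (U : EuclideanSpace ℂ V ≃ₗᵢ[ℂ] EuclideanSpace ℂ V)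

@[simp] theorem apply_nil (Ψ : Joint V Q) : Circuit.apply U [] Ψ = Ψ := rfl

@[simp] theorem apply_cons (g : Gate Q) (C : Circuit Q) (Ψ : Joint V Q) :
    Circuit.apply U (g :: C) Ψ = C.apply U (g.apply U Ψ) := rfl

theorem apply_append (C D : Circuit Q) (Ψ : Joint V Q) :
    Circuit.apply U (C ++ D) Ψ = D.apply U (C.apply U Ψ) :=
  List.foldl_append ..

theorem apply_add (C : Circuit Q) (Ψ Φ : Joint V Q) :
    C.apply U (Ψ + Φ) = C.apply U Ψ + C.apply U Φ := by
  induction C generalizing Ψ Φ with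
  | nil => rfl
  | cons g C ih => rw [apply_cons, apply_cons, apply_cons, Gate.apply_add, ih]

/-- Hadamard gates and calls suffice here, because norms are compared only across probes and their
inverses. -/
theorem norm_apply [Fintype Q] {C : Circuit Q} (hC : ∀ g ∈ C, g.isHadamard ∨ g.isCall)
    (Ψ : Joint V Q) : ‖C.apply U Ψ‖ = ‖Ψ‖ := by
  induction C generalizing Ψ with
  | nil => rfl
  | cons g C ih =>
    rw [apply_cons, ih fun g hg => hC g (List.mem_cons_of_mem _ hg)]
    have := hC g List.mem_cons_self
    cases g <;> simp [Gate.isHadamard, Gate.isCall] at this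
    · exact norm_hadamard U _ _
    · exact norm_call U _ _
    · exact norm_callInv U _ _

end Circuit

/-! ### Averages of powers of a unitary and their decay under a gap. -/

section Average

variable {E : Type*} [NormedAddCommGroup E] [InnerProductSpace ℂ E] (U : E ≃ₗᵢ[ℂ] E)

omit [InnerProductSpace ℂ E] in
theorem isometryEquiv_mul_apply [NormedSpace ℂ E] (U W : E ≃ₗᵢ[ℂ] E) (ψ : E) :
    (U * W) ψ = U (W ψ) := rfl

/-- The average `2⁻ˢ ∑ i < 2ˢ, Uⁱ`, computed by repeated halving. -/
def average : ℕ → E → E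
  | 0, ψ => ψ
  | s + 1, ψ => (1 / 2 : ℂ) • (average s ψ + (U ^ 2 ^ s) (average s ψ))

/-- Telescoping of the geometric sum, in dyadic form: 1 − U^(2^(s+1)) = (1 + U^(2^s))(1 − U^(2^s)).
-/
theorem average_sub (s : ℕ) (ψ : E) :
    average U s ψ - U (average U s ψ) = ((1 / 2 : ℂ) ^ s) • (ψ - (U ^ 2 ^ s) ψ) := by
  induction s with
  | zero => simp [average]
  | succ s ih =>
    have h1 : U ((U ^ 2 ^ s) (average U s ψ)) = (U ^ 2 ^ s) (U (average U s ψ)) := by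
      rw [← isometryEquiv_mul_apply, ← isometryEquiv_mul_apply, ← pow_succ, ← pow_succ']
    have h2 := congrArg (fun x => (U ^ 2 ^ s) x) ih
    have h3 : (U ^ 2 ^ s) ((U ^ 2 ^ s) ψ) = (U ^ 2 ^ (s + 1)) ψ := by
      rw [← isometryEquiv_mul_apply, ← pow_add, ← two_mul, ← pow_succ']
    simp only [map_sub, map_smul, h3] at h2
    rw [average, map_smul, map_add, h1, ← smul_sub, pow_succ', mul_smul]
    congr 1
    rw [add_sub_add_comm, ih, h2, ← smul_add]
    congr 1
    abel

theorem average_mem {K : Submodule ℂ E} (hK : ∀ ψ ∈ K, U ψ ∈ K) (s : ℕ) {ψ : E} (hψ : ψ ∈ K) :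
    average U s ψ ∈ K := by
  have hpow (t : ℕ) : ∀ ψ ∈ K, (U ^ t) ψ ∈ K := by
    induction t with
    | zero => exact fun ψ h => h
    | succ t ih => exact fun ψ h => by rw [pow_succ', isometryEquiv_mul_apply]; exact hK _ (ih _ h)
  induction s with
  | zero => exact hψ
  | succ s ih => exact K.smul_mem _ (K.add_mem ih (hpow _ _ ih))

/-- By `average_sub` the displacement of the average is at most 2·2^(−s)‖ψ‖; the gap turns this into
a bound on the average itself. -/
theorem norm_average_le {g : ℝ} {s : ℕ} (hs : 4 ≤ g * 2 ^ s) {ψ : E}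
    (h : g * ‖average U s ψ‖ ≤ ‖average U s ψ - U (average U s ψ)‖) :
    ‖average U s ψ‖ ≤ (1 / 2) * ‖ψ‖ := by
  rw [average_sub, norm_smul, norm_pow] at h
  have h1 : ‖ψ - (U ^ 2 ^ s) ψ‖ ≤ 2 * ‖ψ‖ := by
    refine (norm_sub_le _ _).trans ?_
    rw [LinearIsometryEquiv.norm_map]; linarith
  have h2 : ‖(1 / 2 : ℂ)‖ ^ s * 2 ^ s = 1 := by
    rw [← mul_pow]; norm_num
  have h3 : 4 * ‖average U s ψ‖ ≤ 2 * ‖ψ‖ :=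
    calc 4 * ‖average U s ψ‖ ≤ g * 2 ^ s * ‖average U s ψ‖ := by gcongr
      _ = (g * ‖average U s ψ‖) * 2 ^ s := by ring
      _ ≤ (‖(1 / 2 : ℂ)‖ ^ s * (2 * ‖ψ‖)) * 2 ^ s := by gcongr ?_ * _; exact h.trans (by gcongr)
      _ = 2 * ‖ψ‖ := by rw [mul_right_comm, h2, one_mul]
  linarith

theorem norm_iterate_average_le {K : Submodule ℂ E} (hK : ∀ ψ ∈ K, U ψ ∈ K) {g : ℝ}
    (h : ∀ ψ ∈ K, g * ‖ψ‖ ≤ ‖ψ - U ψ‖) {s : ℕ} (hs : 4 ≤ g * 2 ^ s) (m : ℕ) {ψ : E}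
    (hψ : ψ ∈ K) : ‖(average U s)^[m] ψ‖ ≤ (1 / 2) ^ m * ‖ψ‖ := by
  induction m generalizing ψ with
  | zero => simp
  | succ m ih =>
    rw [Function.iterate_succ_apply, pow_succ, mul_assoc]
    refine (ih (average_mem U hK s hψ)).trans ?_
    gcongr
    exact norm_average_le U hs (h _ (average_mem U hK s hψ))

end Average

/-! ### Probes and the average that they compute. -/

namespace Circuit

variable {V : Type*} {Q Q' : Type}

/-- Prepare the control qubit `x.1`, call the unitary `x.2` times, and undo the preparation. -/
def probe (x : Q × ℕ) : Circuit Q :=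
  .hadamard x.1 :: (List.replicate x.2 (.call x.1) ++ [.hadamard x.1])

/-- The shape is that of `probe` because the Hadamard gate is its own inverse. -/
def probeInv (x : Q × ℕ) : Circuit Q :=
  .hadamard x.1 :: (List.replicate x.2 (.callInv x.1) ++ [.hadamard x.1])

def probes (l : List (Q × ℕ)) : Circuit Q := l.flatMap probe

def probesInv (l : List (Q × ℕ)) : Circuit Q := l.reverse.flatMap probeInv

variable [DecidableEq Q] [Fintype V] (U : EuclideanSpace ℂ V ≃ₗᵢ[ℂ] EuclideanSpace ℂ V)

theorem slice_replicate_call (i : Q) (t : ℕ) (Ψ : Joint V Q) (b : Q → Bool) :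
    slice (Circuit.apply U (List.replicate t (.call i)) Ψ) b =
      if b i then (U ^ t) (slice Ψ b) else slice Ψ b := by
  induction t generalizing Ψ with
  | zero => simp
  | succ t ih =>
    rw [List.replicate_succ, apply_cons, ih, slice_call]
    split_ifs with h
    · rw [pow_succ, isometryEquiv_mul_apply]
    · rfl

theorem apply_callInv_call (i : Q) (t : ℕ) (Ψ : Joint V Q) :
    Circuit.apply U (List.replicate t (.callInv i))
      (Circuit.apply U (List.replicate t (.call i)) Ψ) = Ψ := by
  induction t generalizing Ψ with
  | zero => rfl
  | succ t ih =>
    rw [List.replicate_succ' (a := Gate.callInv i), List.replicate_succ, apply_append, apply_cons,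
      apply_cons, apply_nil, ih, callInv_call]

theorem probeInv_probe (x : Q × ℕ) (Ψ : Joint V Q) :
    (probeInv x).apply U ((probe x).apply U Ψ) = Ψ := by
  simp only [probe, probeInv, apply_cons, apply_append, apply_nil, hadamard_hadamard,
    apply_callInv_call]

theorem probesInv_probes (l : List (Q × ℕ)) (Ψ : Joint V Q) :
    (probesInv l).apply U ((probes l).apply U Ψ) = Ψ := by
  induction l generalizing Ψ with
  | nil => rfl
  | cons x l ih =>
    simp only [probes, probesInv, List.flatMap_cons, List.reverse_cons, List.flatMap_append,
      List.flatMap_nil, List.append_nil, apply_append] at ih ⊢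
    rw [ih, probeInv_probe]

/-- On states whose amplitudes are fixed by the unitary, a probe has no effect. -/
theorem probe_of_fixed (x : Q × ℕ) {Ψ : Joint V Q} (h : ∀ b, U (slice Ψ b) = slice Ψ b) :
    (probe x).apply U Ψ = Ψ := by
  simp only [probe, apply_cons, apply_append, apply_nil]
  suffices h1 : Circuit.apply U (List.replicate x.2 (.call x.1)) ((Gate.hadamard x.1).apply U Ψ) =
      (Gate.hadamard x.1).apply U Ψ by rw [h1, hadamard_hadamard]
  refine slice_ext fun b => ?_
  rw [slice_replicate_call]
  have h2 : ∀ t : ℕ, (U ^ t) (slice ((Gate.hadamard x.1).apply U Ψ) b) =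
      slice ((Gate.hadamard x.1).apply U Ψ) b := by
    intro t
    induction t with
    | zero => rfl
    | succ t ih =>
      rw [pow_succ', isometryEquiv_mul_apply, ih, slice_hadamard, map_smul, map_add, map_smul,
        h, h]
  rw [h2, ite_self]

theorem probes_of_fixed (l : List (Q × ℕ)) {Ψ : Joint V Q}
    (h : ∀ b, U (slice Ψ b) = slice Ψ b) : (probes l).apply U Ψ = Ψ := by
  induction l with
  | nil => rfl
  | cons x l ih => rw [probes, List.flatMap_cons, apply_append, probe_of_fixed U x h]; exact ih

theorem probesInv_of_fixed (l : List (Q × ℕ)) {Ψ : Joint V Q}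
    (h : ∀ b, U (slice Ψ b) = slice Ψ b) : (probesInv l).apply U Ψ = Ψ := by
  conv_lhs => rw [← probes_of_fixed U l h]
  exact probesInv_probes U l Ψ

theorem slice_probe (x : Q × ℕ) (Ψ : Joint V Q) (b : Q → Bool) :
    slice ((probe x).apply U Ψ) b = (1 / 2 : ℂ) •
      ((slice Ψ (Function.update b x.1 false) + slice Ψ (Function.update b x.1 true)) +
        (if b x.1 then (-1 : ℂ) else 1) • (U ^ x.2)
          (slice Ψ (Function.update b x.1 false) - slice Ψ (Function.update b x.1 true))) := by
  have h2 : (√2 : ℂ)⁻¹ * (√2 : ℂ)⁻¹ = 1 / 2 := by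
    rw [← mul_inv]; norm_cast; rw [Real.mul_self_sqrt zero_le_two]; norm_num
  simp only [probe, apply_cons, apply_append, apply_nil, slice_hadamard, slice_replicate_call,
    Function.update_self, Function.update_idem, Bool.false_eq_true, if_false, if_true, one_smul]
  rw [map_smul, neg_smul, one_smul, ← sub_eq_add_neg, smul_comm _ ((√2 : ℂ)⁻¹), ← smul_add,
    smul_smul, h2]

/-- The amplitudes vanish unless all qubits outside `S` are zero. -/
def SupportedOn (Ψ : Joint V Q) (S : Set Q) : Prop := ∀ b, ∀ i ∉ S, b i = true → slice Ψ b = 0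

theorem SupportedOn.probe {Ψ : Joint V Q} {S : Set Q} (h : SupportedOn Ψ S) (x : Q × ℕ) :
    SupportedOn ((probe x).apply U Ψ) (insert x.1 S) := by
  intro b i hi hb
  rw [Set.mem_insert_iff, not_or] at hi
  rw [slice_probe, h _ i hi.2 (by rwa [Function.update_of_ne hi.1]),
    h _ i hi.2 (by rwa [Function.update_of_ne hi.1])]
  simp

/-- A fresh qubit contributes no amplitude with value one, so only the zero amplitude enters. -/
theorem slice_zero_probe {Ψ : Joint V Q} {S : Set Q} (h : SupportedOn Ψ S) {x : Q × ℕ}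
    (hx : x.1 ∉ S) :
    slice ((Circuit.probe x).apply U Ψ) (fun _ => false) = (1 / 2 : ℂ) •
      (slice Ψ (fun _ => false) + (U ^ x.2) (slice Ψ (fun _ => false))) := by
  rw [slice_probe, h (Function.update _ x.1 true) x.1 hx (Function.update_self ..)]
  simp

theorem SupportedOn.probes {Ψ : Joint V Q} {S : Set Q} (h : SupportedOn Ψ S)
    (l : List (Q × ℕ)) :
    SupportedOn ((Circuit.probes l).apply U Ψ) (S ∪ {i | i ∈ l.map Prod.fst}) := by
  induction l generalizing Ψ S with
  | nil => simpa [Circuit.probes] using h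
  | cons x l ih =>
    have := ih (h.probe U x)
    rw [Circuit.probes, List.flatMap_cons, apply_append]
    have hset : S ∪ {i | i ∈ (x :: l).map Prod.fst} =
        insert x.1 S ∪ {i | i ∈ l.map Prod.fst} := by
      ext i
      simp only [List.map_cons, List.mem_cons, Set.mem_union, Set.mem_insert_iff]
      change (i ∈ S ∨ (i = x.1 ∨ i ∈ l.map Prod.fst)) ↔ ((i = x.1 ∨ i ∈ S) ∨ i ∈ l.map Prod.fst)
      tauto
    rw [hset]
    exact this

/-- Distinct control qubits keep every probe fresh, so the zero amplitude evolves on its own. -/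
theorem slice_zero_probes {Ψ : Joint V Q} {S : Set Q} (h : SupportedOn Ψ S) {l : List (Q × ℕ)}
    (hl : (l.map Prod.fst).Nodup) (hS : ∀ i ∈ l.map Prod.fst, i ∉ S) :
    slice ((Circuit.probes l).apply U Ψ) (fun _ => false) =
      l.foldl (fun φ x => (1 / 2 : ℂ) • (φ + (U ^ x.2) φ)) (slice Ψ fun _ => false) := by
  induction l generalizing Ψ S with
  | nil => rfl
  | cons x l ih =>
    rw [List.map_cons, List.nodup_cons] at hl
    rw [Circuit.probes, List.flatMap_cons, apply_append, List.foldl_cons,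
      ← slice_zero_probe U h (hS x.1 List.mem_cons_self)]
    refine ih (h.probe U x) hl.2 fun i hi => ?_
    rw [Set.mem_insert_iff, not_or]
    exact ⟨fun h' => hl.1 (h' ▸ hi), hS i (List.mem_cons_of_mem _ hi)⟩

omit [DecidableEq Q] [Fintype V] in
theorem supportedOn_withZeros [Fintype Q] (ψ : EuclideanSpace ℂ V) :
    SupportedOn (withZeros ψ : Joint V Q) ∅ := by
  intro b i _ hb
  rw [slice_withZeros, if_neg]
  rintro rfl
  exact Bool.false_ne_true hb

end Circuit

/-- Control qubits, in `m` blocks of `s`, with the numbers of calls they control. -/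
def schedule {Q : Type} (q : ℕ → Q) (m s : ℕ) : List (Q × ℕ) :=
  (List.range m).flatMap fun b => (List.range s).map fun j => (q (b * s + j), 2 ^ j)

theorem schedule_succ {Q : Type} (q : ℕ → Q) (m s : ℕ) :
    schedule q (m + 1) s =
      schedule q m s ++ (List.range s).map fun j => (q (m * s + j), 2 ^ j) := by
  simp [schedule, List.range_succ, List.flatMap_append]

theorem map_fst_schedule {Q : Type} (q : ℕ → Q) (m s : ℕ) :
    (schedule q m s).map Prod.fst = (List.range (m * s)).map q := by
  induction m with
  | zero => simp [schedule]
  | succ m ih =>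
    rw [schedule_succ, List.map_append, ih, Nat.add_one_mul, List.range_add, List.map_append,
      List.map_map, List.map_map]
    rfl

/-- One block applies the factors (1 + U^(2^j))/2 for j < s, which is the recursion of `average`;
the blocks iterate it. -/
theorem foldl_schedule {E : Type*} [NormedAddCommGroup E] [InnerProductSpace ℂ E]
    {Q : Type} (U : E ≃ₗᵢ[ℂ] E) (q : ℕ → Q) (m s : ℕ) (ψ : E) :
    (schedule q m s).foldl (fun φ x => (1 / 2 : ℂ) • (φ + (U ^ x.2) φ)) ψ =
      (average U s)^[m] ψ := by
  have hblock (b s : ℕ) (ψ : E) :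
      ((List.range s).map fun j => (q (b + j), 2 ^ j)).foldl
        (fun φ x => (1 / 2 : ℂ) • (φ + (U ^ x.2) φ)) ψ = average U s ψ := by
    induction s with
    | zero => rfl
    | succ s ih =>
      rw [List.range_succ, List.map_append, List.foldl_append, ih]; rfl
  induction m with
  | zero => simp [schedule]
  | succ m ih =>
    rw [schedule_succ, List.foldl_append, ih, hblock, Function.iterate_succ_apply']

/-! ### The sign change controlled by many qubits, and the phase flip built from it. -/

namespace Circuit

variable {V : Type*} {Q : Type}

/-- Record in the qubit `a (i + 1)` whether `a i` is one and `d i` is zero. -/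
def link (d a : ℕ → Q) (i : ℕ) : Circuit Q :=
  [.not (d i), .toffoli (a i) (d i) (a (i + 1)), .not (d i)]

def chain (d a : ℕ → Q) (n : ℕ) : Circuit Q := (List.range n).flatMap (link d a)

def chainRev (d a : ℕ → Q) (n : ℕ) : Circuit Q := (List.range n).reverse.flatMap (link d a)

/-- Multiply by `-1` if one of the qubits `d 0, …, d (n - 1)` is one, using the work qubits
`a 0, …, a n`. -/
def flipSome (d a : ℕ → Q) (n : ℕ) : Circuit Q :=
  .not (a 0) :: (chain d a n ++
    ([.not (a n), .cphase (a 0) (a n) 1 false, .not (a n)] ++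
      (chainRev d a n ++ [.not (a 0)])))

variable [DecidableEq Q] [Fintype V] (U : EuclideanSpace ℂ V ≃ₗᵢ[ℂ] EuclideanSpace ℂ V)

/-- The permutation of the basis states that `link` implements. -/
def linkPerm (d a : ℕ → Q) (i : ℕ) (b : Q → Bool) : Q → Bool :=
  Function.update b (a (i + 1)) (xor (b (a (i + 1))) (b (a i) && !(b (d i))))

/-- Slices transform by substitution, so the last gates of `chainRev` are the first to act on a
basis state; hence link 0 is innermost. -/
def chainPerm (d a : ℕ → Q) : ℕ → (Q → Bool) → Q → Bool
  | 0, b => b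
  | n + 1, b => linkPerm d a n (chainPerm d a n b)

theorem update_not_update_not (b : Q → Bool) (i : Q) :
    Function.update (Function.update b i (!(b i))) i (!(Function.update b i (!(b i)) i)) = b := by
  simp

theorem slice_link {d a : ℕ → Q} {i : ℕ} (h0 : d i ≠ a i) (h1 : d i ≠ a (i + 1))
    (Ψ : Joint V Q) (b : Q → Bool) :
    slice ((link d a i).apply U Ψ) b = slice Ψ (linkPerm d a i b) := by
  simp only [link, apply_cons, apply_nil, slice_not, slice_toffoli]
  congr 1
  funext j
  by_cases hj : j = d i
  · subst hj
    simp [linkPerm, h1]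
  · by_cases hj' : j = a (i + 1)
    · subst hj'
      simp [linkPerm, hj, h0.symm]
    · simp [linkPerm, hj, hj']

theorem linkPerm_linkPerm {d a : ℕ → Q} {i : ℕ} (h1 : d i ≠ a (i + 1)) (h2 : a i ≠ a (i + 1))
    (b : Q → Bool) : linkPerm d a i (linkPerm d a i b) = b := by
  simp [linkPerm, h1, h2]

/-- Conjugating a diagonal circuit by a chain permutes its phases. -/
theorem slice_chain_conj {d a : ℕ → Q} {L : ℕ} (hda : ∀ i < L, ∀ j ≤ L, d i ≠ a j)
    (haa : ∀ i ≤ L, ∀ j ≤ L, a i = a j → i = j) {n : ℕ} (hn : n ≤ L) {M : Circuit Q}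
    {φ : (Q → Bool) → ℂ} (hM : ∀ (Ψ : Joint V Q) b, slice (M.apply U Ψ) b = φ b • slice Ψ b)
    (Ψ : Joint V Q) (b : Q → Bool) :
    slice (Circuit.apply U (chain d a n ++ (M ++ chainRev d a n)) Ψ) b =
      φ (chainPerm d a n b) • slice Ψ b := by
  induction n generalizing M φ Ψ with
  | zero => simpa [chain, chainRev, chainPerm] using hM Ψ b
  | succ n ih =>
    have h0 : d n ≠ a n := hda n (by omega) n (by omega)
    have h1 : d n ≠ a (n + 1) := hda n (by omega) (n + 1) (by omega)
    have h2 : a n ≠ a (n + 1) := fun h => by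
      have := haa n (by omega) (n + 1) (by omega) h
      omega
    -- The innermost pair of links is absorbed into M. The result is again diagonal because the link
    -- is an involution.
    have hM' (Ψ : Joint V Q) (b : Q → Bool) :
        slice (Circuit.apply U (link d a n ++ (M ++ link d a n)) Ψ) b =
          φ (linkPerm d a n b) • slice Ψ b := by
      rw [apply_append, apply_append, slice_link U h0 h1, hM, slice_link U h0 h1,
        linkPerm_linkPerm h1 h2]
    have := ih (by omega) hM' Ψ
    simpa [chain, chainRev, List.range_succ, List.flatMap_append, chainPerm] using this

omit [Fintype V] in
-- The chain accumulates the conjunction of the negated `d i` along the work qubits. Later work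
-- qubits are still zero, so each xor amounts to writing the value.
theorem chainPerm_spec {d a : ℕ → Q} {L : ℕ} (hda : ∀ i < L, ∀ j ≤ L, d i ≠ a j)
    (haa : ∀ i ≤ L, ∀ j ≤ L, a i = a j → i = j) {b : Q → Bool} (h0 : b (a 0) = true)
    (hb : ∀ j ≤ L, j ≠ 0 → b (a j) = false) {n : ℕ} (hn : n ≤ L) :
    (chainPerm d a n b (a n) = true ↔ ∀ i < n, b (d i) = false) ∧
      chainPerm d a n b (a 0) = true ∧
      (∀ j ≤ L, n < j → chainPerm d a n b (a j) = false) ∧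
      ∀ i < L, chainPerm d a n b (d i) = b (d i) := by
  induction n with
  | zero => exact ⟨by simp [chainPerm, h0], h0, fun j hj h => hb j hj h.ne', fun _ _ => rfl⟩
  | succ n ih =>
    obtain ⟨ih1, ih2, ih3, ih4⟩ := ih (by omega)
    have hne : ∀ j ≤ L, j ≠ n + 1 → a j ≠ a (n + 1) := fun j hj h h' =>
      h (haa j hj (n + 1) hn h')
    refine ⟨?_, ?_, ?_, ?_⟩
    · rw [chainPerm, linkPerm, Function.update_self, ih3 (n + 1) hn (by omega),
        ih4 n (by omega), Bool.false_xor, Bool.and_eq_true, ih1, Bool.not_eq_true']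
      constructor
      · rintro ⟨h1, h2⟩ i hi
        rcases Nat.lt_succ_iff_lt_or_eq.1 hi with h | rfl
        · exact h1 i h
        · exact h2
      · exact fun h => ⟨fun i hi => h i (by omega), h n (by omega)⟩
    · rw [chainPerm, linkPerm, Function.update_of_ne (hne 0 (by omega) (by omega)), ih2]
    · intro j hj h
      rw [chainPerm, linkPerm, Function.update_of_ne (hne j hj (by omega)), ih3 j hj (by omega)]
    · intro i hi
      rw [chainPerm, linkPerm, Function.update_of_ne (hda i hi _ hn), ih4 i hi]

/-- Nothing is claimed about φ when a work qubit is one: probes leave the work qubits at zero, so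
such states carry no amplitude. -/
theorem slice_flipSome {d a : ℕ → Q} {L : ℕ} (hL : 0 < L) (hda : ∀ i < L, ∀ j ≤ L, d i ≠ a j)
    (haa : ∀ i ≤ L, ∀ j ≤ L, a i = a j → i = j) :
    ∃ φ : (Q → Bool) → ℂ,
      (∀ (Ψ : Joint V Q) b, slice ((flipSome d a L).apply U Ψ) b = φ b • slice Ψ b) ∧
      (∀ b, (∀ j ≤ L, b (a j) = false) → (∃ i < L, b (d i) = true) → φ b = -1) ∧
      (∀ b, (∀ j ≤ L, b (a j) = false) → (∀ i < L, b (d i) = false) → φ b = 1) := by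
  have hne : a 0 ≠ a L := fun h => by
    have := haa 0 (by omega) L le_rfl h
    omega
  -- The rotation needs two distinct controls. The qubit `a 0`, set to one beforehand, serves as the
  -- trivial one, and the negated `a L` detects that some `d i` is one.
  let ω : (Q → Bool) → ℂ := fun b => if b (a 0) && !(b (a L)) then -1 else 1
  have hM (Ψ : Joint V Q) (b : Q → Bool) :
      slice (Circuit.apply U [.not (a L), .cphase (a 0) (a L) 1 false, .not (a L)] Ψ) b =
        ω b • slice Ψ b := by
    simp only [apply_cons, apply_nil, slice_not, slice_cphase_one]
    rw [update_not_update_not, Function.update_self, Function.update_of_ne hne]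
  let flip : (Q → Bool) → Q → Bool := fun b => Function.update b (a 0) (!(b (a 0)))
  have hspec (b : Q → Bool) (hb : ∀ j ≤ L, b (a j) = false) :=
    chainPerm_spec (b := flip b) hda haa (by simp [flip, hb 0 (by omega)]) (fun j hj hj0 => by
      simp only [flip]
      rw [Function.update_of_ne fun h => hj0 (haa j hj 0 (by omega) h), hb j hj]) le_rfl
  have hflip (b : Q → Bool) (i : ℕ) (hi : i < L) : flip b (d i) = b (d i) :=
    Function.update_of_ne (hda i hi 0 (by omega)) _ _
  refine ⟨fun b => ω (chainPerm d a L (flip b)), ?_, ?_, ?_⟩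
  · intro Ψ b
    have h1 : (flipSome d a L).apply U Ψ = (Gate.not (a 0)).apply U
        (Circuit.apply U (chain d a L ++ ([.not (a L), .cphase (a 0) (a L) 1 false, .not (a L)] ++
          chainRev d a L)) ((Gate.not (a 0)).apply U Ψ)) := by
      simp only [flipSome, apply_cons, apply_append, apply_nil]
    rw [h1, slice_not, slice_chain_conj U hda haa le_rfl hM, slice_not, update_not_update_not]
  · rintro b hb ⟨i, hi, hbi⟩
    obtain ⟨h1, h2, -, -⟩ := hspec b hb
    have h3 : chainPerm d a L (flip b) (a L) = false := by
      rw [← Bool.not_eq_true, h1]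
      intro h
      have := h i hi
      rw [hflip b i hi, hbi] at this
      exact Bool.noConfusion this
    simp only [ω, h2, h3]
    simp
  · intro b hb hd
    obtain ⟨h1, h2, -, -⟩ := hspec b hb
    have h3 : chainPerm d a L (flip b) (a L) = true :=
      h1.2 fun i hi => (hflip b i hi).trans (hd i hi)
    simp only [ω, h3]
    simp

/-- Flip the phase of everything that the probes of `m` blocks of `s` qubits detect. -/
def phaseFlip {Q : Type} (q : ℕ → Q) (m s : ℕ) : Circuit Q :=
  probes (schedule q m s) ++
    (flipSome q (fun i => q (m * s + i)) (m * s) ++ probesInv (schedule q m s))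

section PhaseFlip

variable {n m s : ℕ} {q : ℕ → Q}

/-- Controls occupy the first ms positions and work qubits the next ms + 1; the extra one makes the
inequality strict. -/
theorem slice_flipSome_of_injOn (hq : Set.InjOn q (Set.Iio n)) (hL : 0 < m * s)
    (hn : m * s + m * s < n) :
    ∃ φ : (Q → Bool) → ℂ,
      (∀ (Ψ : Joint V Q) b, slice ((flipSome q (fun i => q (m * s + i)) (m * s)).apply U Ψ) b =
        φ b • slice Ψ b) ∧
      (∀ b, (∀ j ≤ m * s, b (q (m * s + j)) = false) → (∃ i < m * s, b (q i) = true) →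
        φ b = -1) ∧
      (∀ b, (∀ j ≤ m * s, b (q (m * s + j)) = false) → (∀ i < m * s, b (q i) = false) →
        φ b = 1) := by
  refine slice_flipSome U hL ?_ ?_
  · intro i hi j hj h
    have := hq (Set.mem_Iio.2 (by omega)) (Set.mem_Iio.2 (by omega)) h
    omega
  · intro i hi j hj h
    have := hq (Set.mem_Iio.2 (by omega)) (Set.mem_Iio.2 (by omega)) h
    omega

variable [Fintype Q]

theorem phaseFlip_of_fixed (hq : Set.InjOn q (Set.Iio n)) (hL : 0 < m * s)
    (hn : m * s + m * s < n) {ψ : EuclideanSpace ℂ V} (hψ : U ψ = ψ) :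
    (phaseFlip q m s).apply U (withZeros ψ) = withZeros ψ := by
  have hfix (b : Q → Bool) : U (slice (withZeros ψ : Joint V Q) b) = slice (withZeros ψ) b := by
    rw [slice_withZeros]; split_ifs <;> simp [hψ]
  obtain ⟨φ, h1, -, h3⟩ := slice_flipSome_of_injOn (V := V) U hq hL hn
  have hmid : (flipSome q (fun i => q (m * s + i)) (m * s)).apply U (withZeros ψ) =
      withZeros ψ := by
    refine slice_ext fun b => ?_
    rw [h1, slice_withZeros]
    split_ifs with hb
    · subst hb
      rw [h3 _ (fun _ _ => rfl) (fun _ _ => rfl), one_smul]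
    · simp
  rw [phaseFlip, apply_append, apply_append, probes_of_fixed U _ hfix, hmid,
    probesInv_of_fixed U _ hfix]

omit [DecidableEq Q] [Fintype Q] in
theorem nodup_map_fst_schedule (hq : Set.InjOn q (Set.Iio n)) (hn : m * s ≤ n) :
    ((schedule q m s).map Prod.fst).Nodup := by
  rw [map_fst_schedule]
  refine List.Nodup.map_on (fun i hi j hj h => ?_) List.nodup_range
  rw [List.mem_range] at hi hj
  exact hq (Set.mem_Iio.2 (by omega)) (Set.mem_Iio.2 (by omega)) h

theorem slice_zero_probes_schedule (hq : Set.InjOn q (Set.Iio n)) (hn : m * s ≤ n)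
    (ψ : EuclideanSpace ℂ V) :
    slice ((probes (schedule q m s)).apply U (withZeros ψ)) (fun _ : Q => false) =
      (average U s)^[m] ψ := by
  rw [slice_zero_probes U (supportedOn_withZeros ψ) (nodup_map_fst_schedule hq hn)
    (fun _ _ => Set.notMem_empty _), slice_withZeros_zero, foldl_schedule]

omit [DecidableEq Q] [Fintype Q] in
theorem probe_isHadamard_or_isCall (l : List (Q × ℕ)) :
    ∀ g ∈ probes l, g.isHadamard ∨ g.isCall := by
  intro g hg
  simp only [probes, probe, List.mem_flatMap, List.mem_cons, List.mem_append, List.mem_replicate,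
    List.not_mem_nil, or_false] at hg
  obtain ⟨x, -, rfl | ⟨-, rfl⟩ | rfl⟩ := hg <;> simp [Gate.isHadamard, Gate.isCall]

omit [DecidableEq Q] [Fintype Q] in
theorem probeInv_isHadamard_or_isCall (l : List (Q × ℕ)) :
    ∀ g ∈ probesInv l, g.isHadamard ∨ g.isCall := by
  intro g hg
  simp only [probesInv, probeInv, List.mem_flatMap, List.mem_cons, List.mem_append,
    List.mem_replicate, List.not_mem_nil, or_false] at hg
  obtain ⟨x, -, rfl | ⟨-, rfl⟩ | rfl⟩ := hg <;> simp [Gate.isHadamard, Gate.isCall]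

/-- Conjugation: F⁻¹ZF + 1 = F⁻¹(Z + 1)F. On the basis states that F reaches, Z is 1 at zero and −1
elsewhere, so Z + 1 doubles the zero amplitude and removes the rest. -/
theorem norm_phaseFlip_add (hq : Set.InjOn q (Set.Iio n)) (hL : 0 < m * s)
    (hn : m * s + m * s < n) (ψ : EuclideanSpace ℂ V) :
    ‖(phaseFlip q m s).apply U (withZeros ψ) + withZeros ψ‖ = 2 * ‖(average U s)^[m] ψ‖ := by
  obtain ⟨φ, h1, h2, h3⟩ := slice_flipSome_of_injOn (V := V) U hq hL hn
  set F := probes (schedule q m s)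
  set Z := flipSome q (fun i => q (m * s + i)) (m * s)
  have hsup := (supportedOn_withZeros (Q := Q) ψ).probes U (schedule q m s)
  have hout (b : Q → Bool) (i : Q) (hi : ∀ j < m * s, q j ≠ i) (hb : b i = true) :
      slice (F.apply U (withZeros ψ)) b = 0 := by
    refine hsup b i ?_ hb
    rw [Set.empty_union, map_fst_schedule]
    intro h
    obtain ⟨j, hj, hji⟩ := List.mem_map.1 (show i ∈ (List.range (m * s)).map q from h)
    exact hi j (List.mem_range.1 hj) hji
  have key : Z.apply U (F.apply U (withZeros ψ)) + F.apply U (withZeros ψ) =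
      withZeros ((2 : ℂ) • (average U s)^[m] ψ) := by
    refine slice_ext fun b => ?_
    rw [slice_add, h1, slice_withZeros]
    split_ifs with hb
    · subst hb
      rw [h3 _ (fun _ _ => rfl) (fun _ _ => rfl),
        slice_zero_probes_schedule U hq (by omega), one_smul, two_smul]
    · by_cases hz : slice (F.apply U (withZeros ψ)) b = 0
      · simp [hz]
      · have hzero (i : Q) (hi : ∀ j < m * s, q j ≠ i) : b i = false := by
          rw [← Bool.not_eq_true]
          exact fun h => hz (hout b i hi h)
        rw [h2 b]
        · simp
        · intro j hj
          refine hzero _ fun i hi h => ?_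
          have := hq (Set.mem_Iio.2 (by omega)) (Set.mem_Iio.2 (by omega)) h
          omega
        · by_contra! hall
          refine hb (funext fun i => ?_)
          by_cases hi : ∃ j < m * s, q j = i
          · obtain ⟨j, hj, rfl⟩ := hi
            simpa using hall j hj
          · exact hzero i fun j hj h => hi ⟨j, hj, h⟩
  have hinv := probesInv_probes U (schedule q m s) (withZeros ψ)
  have hsum : (phaseFlip q m s).apply U (withZeros ψ) + withZeros ψ =
      (probesInv (schedule q m s)).apply U
        (Z.apply U (F.apply U (withZeros ψ)) + F.apply U (withZeros ψ)) := by
    rw [apply_add, hinv, phaseFlip, apply_append, apply_append]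
  rw [hsum, norm_apply U (probeInv_isHadamard_or_isCall _), key, norm_withZeros, norm_smul]
  simp

end PhaseFlip

end Circuit

/-! ### The whole circuit: definition, gate counts, renaming of qubits. -/

namespace Circuit

variable {V : Type*} {Q Q' : Type}

/-- Probes without calls: each is a pair of Hadamard gates. -/
def idleSchedule (q : ℕ → Q) (p s : ℕ) : List (Q × ℕ) :=
  (List.range p).flatMap fun _ => (List.range s).map fun j => (q j, 0)

/-- The approximate reflection through the stationary state. -/
def approxReflection (q : ℕ → Q) (k s : ℕ) : Circuit Q :=
  if k = 0 ∨ s = 0 then [] else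
    -- With m = (k − 1)/2 and p = (k − 1) % 2 one has k = 2m + p + 1. The phase flip uses the
    -- Hadamard gates of 2m blocks, and idle blocks supply the others.
    probes (idleSchedule q ((k - 1) % 2) s) ++
      if (k - 1) / 2 = 0 then probes (schedule q 1 s)
      else probes (idleSchedule q 1 s) ++ phaseFlip q ((k - 1) / 2) s

section Counts

theorem countP_isHadamard_probes (l : List (Q × ℕ)) :
    (probes l).countP Gate.isHadamard = 2 * l.length := by
  induction l with
  | nil => rfl
  | cons x l ih =>
    rw [probes, List.flatMap_cons, List.countP_append, ← probes, ih]
    simp [probe, List.countP_cons, List.countP_replicate, Gate.isHadamard]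
    ring

theorem countP_isPhase_probes (l : List (Q × ℕ)) : (probes l).countP Gate.isPhase = 0 := by
  induction l with
  | nil => rfl
  | cons x l ih =>
    rw [probes, List.flatMap_cons, List.countP_append, ← probes, ih]
    simp [probe, List.countP_replicate, Gate.isPhase]

theorem countP_isCall_probes (l : List (Q × ℕ)) :
    (probes l).countP Gate.isCall = (l.map Prod.snd).sum := by
  induction l with
  | nil => rfl
  | cons x l ih =>
    rw [probes, List.flatMap_cons, List.countP_append, ← probes, ih]
    simp [probe, List.countP_replicate, Gate.isCall]

theorem probesInv_perm (l : List (Q × ℕ)) : (probesInv l).Perm (l.flatMap probeInv) :=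
  (List.reverse_perm l).flatMap_right _

theorem countP_isHadamard_probesInv (l : List (Q × ℕ)) :
    (probesInv l).countP Gate.isHadamard = 2 * l.length := by
  rw [(probesInv_perm l).countP_eq]
  induction l with
  | nil => rfl
  | cons x l ih =>
    rw [List.flatMap_cons, List.countP_append, ih]
    simp [probeInv, List.countP_cons, List.countP_replicate, Gate.isHadamard]
    ring

theorem countP_isPhase_probesInv (l : List (Q × ℕ)) :
    (probesInv l).countP Gate.isPhase = 0 := by
  rw [(probesInv_perm l).countP_eq]
  induction l with
  | nil => rfl
  | cons x l ih =>
    rw [List.flatMap_cons, List.countP_append, ih]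
    simp [probeInv, List.countP_replicate, Gate.isPhase]

theorem countP_isCall_probesInv (l : List (Q × ℕ)) :
    (probesInv l).countP Gate.isCall = (l.map Prod.snd).sum := by
  rw [(probesInv_perm l).countP_eq]
  induction l with
  | nil => rfl
  | cons x l ih =>
    rw [List.flatMap_cons, List.countP_append, ih]
    simp [probeInv, List.countP_replicate, Gate.isCall]

theorem countP_chain_eq_zero {p : Gate Q → Bool} (hnot : ∀ i, p (.not i) = false)
    (htof : ∀ i j t, p (.toffoli i j t) = false) (d a : ℕ → Q) (n : ℕ) :
    (chain d a n).countP p = 0 ∧ (chainRev d a n).countP p = 0 := by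
  have h (l : List ℕ) : (l.flatMap (link d a)).countP p = 0 := by
    induction l with
    | nil => rfl
    | cons i l ih =>
      rw [List.flatMap_cons, List.countP_append, ih]
      simp [link, hnot, htof]
  exact ⟨h _, h _⟩

theorem countP_flipSome {p : Gate Q → Bool} (hnot : ∀ i, p (.not i) = false)
    (htof : ∀ i j t, p (.toffoli i j t) = false) (d a : ℕ → Q) (n : ℕ) :
    (flipSome d a n).countP p = [Gate.cphase (a 0) (a n) 1 false].countP p := by
  obtain ⟨h1, h2⟩ := countP_chain_eq_zero hnot htof d a n
  simp [flipSome, List.countP_cons, List.countP_append, h1, h2, hnot]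

theorem length_schedule (q : ℕ → Q) (m s : ℕ) : (schedule q m s).length = m * s := by
  simpa using congrArg List.length (map_fst_schedule q m s)

theorem length_idleSchedule (q : ℕ → Q) (p s : ℕ) : (idleSchedule q p s).length = p * s := by
  simp [idleSchedule, List.length_flatMap]

theorem sum_map_snd_schedule (q : ℕ → Q) (m s : ℕ) :
    ((schedule q m s).map Prod.snd).sum ≤ m * 2 ^ s := by
  have h (s : ℕ) : ((List.range s).map fun j => 2 ^ j).sum ≤ 2 ^ s := by
    induction s with
    | zero => simp
    | succ s ih =>
      rw [List.range_succ, List.map_append, List.sum_append, pow_succ]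
      simp only [List.map_cons, List.map_nil, List.sum_cons, List.sum_nil]
      omega
  induction m with
  | zero => simp [schedule]
  | succ m ih =>
    rw [schedule_succ, List.map_append, List.sum_append, add_one_mul, List.map_map]
    exact add_le_add ih (h s)

theorem sum_map_snd_idleSchedule (q : ℕ → Q) (p s : ℕ) :
    ((idleSchedule q p s).map Prod.snd).sum = 0 := by
  refine List.sum_eq_zero fun x hx => ?_
  simp only [idleSchedule, List.mem_map, List.mem_flatMap] at hx
  obtain ⟨_, ⟨_, -, _, -, rfl⟩, rfl⟩ := hx
  rfl

theorem countP_isHadamard_approxReflection (q : ℕ → Q) (k s : ℕ) :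
    (approxReflection q k s).countP Gate.isHadamard = 2 * k * s := by
  unfold approxReflection
  split_ifs with h1 h2
  · rcases h1 with rfl | rfl <;> simp
  · rw [List.countP_append, countP_isHadamard_probes, countP_isHadamard_probes, length_schedule,
      length_idleSchedule]
    rw [show k = (k - 1) % 2 + 1 by omega]
    simp; ring
  · rw [phaseFlip, List.countP_append, List.countP_append, List.countP_append, List.countP_append,
      countP_isHadamard_probes, countP_isHadamard_probes, countP_isHadamard_probes,
      countP_isHadamard_probesInv, countP_flipSome (fun _ => rfl) (fun _ _ _ => rfl),
      length_schedule, length_idleSchedule, length_idleSchedule]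
    have hk : k = 2 * ((k - 1) / 2) + (k - 1) % 2 + 1 := by omega
    generalize (k - 1) / 2 = m at hk ⊢
    generalize (k - 1) % 2 = p at hk ⊢
    subst hk
    simp [Gate.isHadamard]; ring

/-- At most one rotation occurs, the one in `flipSome`, and only when k and s are positive. -/
theorem countP_isPhase_approxReflection (q : ℕ → Q) (k s : ℕ) :
    (approxReflection q k s).countP Gate.isPhase ≤ k * s ^ 2 := by
  unfold approxReflection
  split_ifs with h1 h2
  · simp
  · simp [List.countP_append, countP_isPhase_probes]
  · rw [phaseFlip, List.countP_append, List.countP_append, List.countP_append, List.countP_append,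
      countP_isPhase_probes, countP_isPhase_probes, countP_isPhase_probes,
      countP_isPhase_probesInv, countP_flipSome (fun _ => rfl) (fun _ _ _ => rfl)]
    rw [not_or] at h1
    have : 0 < k * s ^ 2 := Nat.mul_pos (by omega) (pow_pos (by omega) 2)
    simp [List.countP_cons, Gate.isPhase]
    omega

theorem countP_isCall_approxReflection (q : ℕ → Q) (k s : ℕ) :
    (approxReflection q k s).countP Gate.isCall ≤ k * 2 ^ (s + 1) := by
  unfold approxReflection
  split_ifs with h1 h2
  · simp
  · rw [List.countP_append, countP_isCall_probes, countP_isCall_probes, sum_map_snd_idleSchedule,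
      zero_add]
    refine (sum_map_snd_schedule q 1 s).trans (Nat.mul_le_mul (by omega) ?_)
    exact Nat.pow_le_pow_right (by omega) (by omega)
  · rw [phaseFlip, List.countP_append, List.countP_append, List.countP_append, List.countP_append,
      countP_isCall_probes, countP_isCall_probes, countP_isCall_probes,
      countP_isCall_probesInv, countP_flipSome (fun _ => rfl) (fun _ _ _ => rfl),
      sum_map_snd_idleSchedule, sum_map_snd_idleSchedule]
    have h3 := sum_map_snd_schedule q ((k - 1) / 2) s
    have h4 : (k - 1) / 2 * 2 ^ s ≤ k * 2 ^ s := Nat.mul_le_mul (by omega) le_rfl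
    rw [pow_succ, ← mul_assoc]
    simp [Gate.isCall]
    omega

end Counts

section Rename

theorem map_rename_probes (f : Q → Q') (l : List (Q × ℕ)) :
    (probes l).map (Gate.rename f id) = probes (l.map fun x => (f x.1, x.2)) := by
  simp [probes, probe, List.map_flatMap, List.flatMap_map, Gate.rename]

theorem map_rename_probesInv (f : Q → Q') (l : List (Q × ℕ)) :
    (probesInv l).map (Gate.rename f id) = probesInv (l.map fun x => (f x.1, x.2)) := by
  simp [probesInv, probeInv, List.map_flatMap, List.flatMap_map, Gate.rename, ← List.map_reverse]

theorem map_rename_flipSome (f : Q → Q') (d a : ℕ → Q) (n : ℕ) :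
    (flipSome d a n).map (Gate.rename f id) = flipSome (f ∘ d) (f ∘ a) n := by
  simp [flipSome, chain, chainRev, link, List.map_flatMap, Gate.rename]
  rfl

theorem map_schedule (f : Q → Q') (q : ℕ → Q) (m s : ℕ) :
    (schedule q m s).map (fun x => (f x.1, x.2)) = schedule (f ∘ q) m s := by
  simp [schedule, List.map_flatMap, Function.comp_def]

theorem map_idleSchedule (f : Q → Q') (q : ℕ → Q) (m s : ℕ) :
    (idleSchedule q m s).map (fun x => (f x.1, x.2)) = idleSchedule (f ∘ q) m s := by
  simp [idleSchedule, List.map_flatMap, Function.comp_def]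

/-- The construction is natural in the naming q of the qubits, so validity and uniformity can be
checked for qubits named by natural numbers. -/
theorem map_rename_approxReflection (f : Q → Q') (q : ℕ → Q) (k s : ℕ) :
    (approxReflection q k s).map (Gate.rename f id) = approxReflection (f ∘ q) k s := by
  unfold approxReflection
  split_ifs
  · rfl
  · simp only [List.map_append, map_rename_probes, map_schedule, map_idleSchedule]
  · simp only [List.map_append, map_rename_probes, map_schedule, map_idleSchedule, phaseFlip,
      map_rename_probesInv, map_rename_flipSome]
    rfl

end Rename

end Circuit

/-! ### Validity, and the passage to qubits indexed by `Fin (k * s)`. -/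

/-- All qubits of the gate are below `n`. -/
def Gate.Within (n : ℕ) : Gate ℕ → Prop
  | hadamard i => i < n
  | cphase i j _ _ => i < n ∧ j < n
  | not t => t < n
  | cnot i t => i < n ∧ t < n
  | toffoli i j t => i < n ∧ j < n ∧ t < n
  | call i => i < n
  | callInv i => i < n

theorem Gate.Within.rename_eq {n : ℕ} {g : Gate ℕ} (h : g.Within n) {f : ℕ → ℕ}
    (hf : ∀ i < n, f i = i) : g.rename f id = g := by
  cases g <;> simp only [Gate.Within] at h <;> simp [Gate.rename, hf, h]

theorem Gate.Valid.rename_of_injOn {n : ℕ} {g : Gate ℕ} (hv : g.Valid) (h : g.Within n)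
    {Q : Type} {f : ℕ → Q} (hf : Set.InjOn f (Set.Iio n)) : (g.rename f id).Valid := by
  have hne {i j : ℕ} (hi : i < n) (hj : j < n) (hij : i ≠ j) : f i ≠ f j :=
    fun h => hij (hf hi hj h)
  cases g <;> simp only [Gate.Within, Gate.Valid, Gate.rename] at *
  · exact hne h.1 h.2 hv
  · exact hne h.1 h.2 hv
  · exact ⟨hne h.1 h.2.1 hv.1, hne h.1 h.2.2 hv.2.1, hne h.2.1 h.2.2 hv.2.2⟩

namespace Circuit

theorem probes_valid_within {n : ℕ} {l : List (ℕ × ℕ)} (hl : ∀ x ∈ l, x.1 < n) :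
    ∀ g ∈ probes l, g.Valid ∧ g.Within n := by
  intro g hg
  simp only [probes, probe, List.mem_flatMap, List.mem_cons, List.mem_append, List.mem_replicate,
    List.not_mem_nil, or_false] at hg
  obtain ⟨x, hx, rfl | ⟨-, rfl⟩ | rfl⟩ := hg <;> exact ⟨trivial, hl x hx⟩

theorem probesInv_valid_within {n : ℕ} {l : List (ℕ × ℕ)} (hl : ∀ x ∈ l, x.1 < n) :
    ∀ g ∈ probesInv l, g.Valid ∧ g.Within n := by
  intro g hg
  simp only [probesInv, probeInv, List.mem_flatMap, List.mem_reverse, List.mem_cons,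
    List.mem_append, List.mem_replicate, List.not_mem_nil, or_false] at hg
  obtain ⟨x, hx, rfl | ⟨-, rfl⟩ | rfl⟩ := hg <;> exact ⟨trivial, hl x hx⟩

theorem fst_lt_of_mem_schedule {m s : ℕ} {x : ℕ × ℕ} (hx : x ∈ schedule id m s) :
    x.1 < m * s := by
  have h : x.1 ∈ (schedule id m s).map Prod.fst := List.mem_map_of_mem hx
  rw [map_fst_schedule] at h
  simpa using h

theorem fst_lt_of_mem_idleSchedule {p s : ℕ} {x : ℕ × ℕ} (hx : x ∈ idleSchedule id p s) :
    x.1 < s := by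
  simp only [idleSchedule, List.mem_flatMap, List.mem_map, List.mem_range] at hx
  obtain ⟨_, -, j, hj, rfl⟩ := hx
  exact hj

theorem flipSome_valid_within {L n : ℕ} (hL : 0 < L) (hn : L + L < n) :
    ∀ g ∈ flipSome id (fun i => id (L + i)) L, g.Valid ∧ g.Within n := by
  have hlink : ∀ i < L, ∀ g ∈ link id (fun i => id (L + i)) i, g.Valid ∧ g.Within n := by
    intro i hi g hg
    simp only [link, List.mem_cons, List.not_mem_nil, or_false, id] at hg
    obtain rfl | rfl | rfl := hg <;> simp only [Gate.Valid, Gate.Within, true_and] <;> omega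
  intro g hg
  simp only [flipSome, chain, chainRev, List.mem_cons, List.mem_append, List.mem_flatMap,
    List.mem_reverse, List.mem_range, List.not_mem_nil, or_false] at hg
  obtain rfl | ⟨i, hi, hg⟩ | (rfl | rfl | rfl) | ⟨i, hi, hg⟩ | rfl := hg
  all_goals first
    | exact hlink i hi g hg
    | (simp only [Gate.Valid, Gate.Within, true_and, id]; omega)

/-- Since 2m ≤ k − 1, at least s ≥ 1 qubits remain beyond 2ms, which provides the last work qubit.
-/
theorem size_bound {k s : ℕ} (hs : s ≠ 0) (hm : (k - 1) / 2 ≠ 0) :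
    (k - 1) / 2 * s + (k - 1) / 2 * s < k * s := by
  rw [← add_mul]
  exact Nat.mul_lt_mul_of_pos_right (by omega) (Nat.pos_of_ne_zero hs)

theorem approxReflection_valid_within (k s : ℕ) :
    ∀ g ∈ approxReflection id k s, g.Valid ∧ g.Within (k * s) := by
  unfold approxReflection
  split_ifs with h1 h2
  · simp
  · rw [not_or] at h1
    have hks : s ≤ k * s := Nat.le_mul_of_pos_left _ (by omega)
    intro g hg
    rcases List.mem_append.1 hg with hg | hg
    · exact probes_valid_within
        (fun x hx => (fst_lt_of_mem_idleSchedule hx).trans_le hks) g hg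
    · exact probes_valid_within
        (fun x hx => (fst_lt_of_mem_schedule hx).trans_le (by rwa [one_mul])) g hg
  · rw [not_or] at h1
    have hks : s ≤ k * s := Nat.le_mul_of_pos_left _ (by omega)
    have hL := size_bound h1.2 h2
    have hL0 : 0 < (k - 1) / 2 * s := Nat.mul_pos (by omega) (by omega)
    intro g hg
    simp only [phaseFlip, List.mem_append] at hg
    obtain hg | hg | hg | hg | hg := hg
    · exact probes_valid_within
        (fun x hx => (fst_lt_of_mem_idleSchedule hx).trans_le hks) g hg
    · exact probes_valid_within
        (fun x hx => (fst_lt_of_mem_idleSchedule hx).trans_le hks) g hg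
    · exact probes_valid_within
        (fun x hx => (fst_lt_of_mem_schedule hx).trans_le (by omega)) g hg
    · exact flipSome_valid_within hL0 hL g hg
    · exact probesInv_valid_within
        (fun x hx => (fst_lt_of_mem_schedule hx).trans_le (by omega)) g hg

end Circuit

/-- The family of approximate reflections, on `k * s` qubits. -/
def reflectionCircuit (k s : ℕ) : Circuit (Fin (k * s)) :=
  if h : 0 < k * s then
    Circuit.approxReflection (fun i => (⟨i % (k * s), Nat.mod_lt _ h⟩ : Fin (k * s))) k s
  else []

theorem approxReflection_eq_nil {Q : Type} (q : ℕ → Q) {k s : ℕ} (h : ¬ 0 < k * s) :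
    Circuit.approxReflection q k s = [] := by
  rw [Circuit.approxReflection, if_pos]
  rw [Nat.pos_iff_ne_zero, not_not, mul_eq_zero] at h
  exact h

/-- Reduction modulo ks only serves to land in `Fin (k * s)`; every index that occurs is already
below ks. -/
theorem map_rename_reflectionCircuit (k s : ℕ) :
    (reflectionCircuit k s).map (Gate.rename (fun i : Fin (k * s) => (i : ℕ)) id) =
      Circuit.approxReflection id k s := by
  unfold reflectionCircuit
  split_ifs with h
  · rw [Circuit.map_rename_approxReflection]
    have h1 := Circuit.map_rename_approxReflection (fun i => i % (k * s)) id k s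
    refine Eq.trans h1.symm ?_
    conv_rhs => rw [← List.map_id (Circuit.approxReflection id k s)]
    refine List.map_congr_left fun g hg => ?_
    exact (Circuit.approxReflection_valid_within k s g hg).2.rename_eq
      fun i hi => Nat.mod_eq_of_lt hi
  · rw [approxReflection_eq_nil _ h]; rfl

theorem injOn_mod {n : ℕ} (h : 0 < n) :
    Set.InjOn (fun i => (⟨i % n, Nat.mod_lt _ h⟩ : Fin n)) (Set.Iio n) := by
  intro i hi j hj hij
  have := congrArg Fin.val hij
  simpa [Nat.mod_eq_of_lt (Set.mem_Iio.1 hi), Nat.mod_eq_of_lt (Set.mem_Iio.1 hj)] using this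

theorem reflectionCircuit_valid (k s : ℕ) : (reflectionCircuit k s).Valid := by
  unfold reflectionCircuit
  split_ifs with h
  · intro g hg
    have h1 := Circuit.map_rename_approxReflection
      (fun i => (⟨i % (k * s), Nat.mod_lt _ h⟩ : Fin (k * s))) id k s
    rw [Function.comp_id] at h1
    rw [← h1, List.mem_map] at hg
    obtain ⟨g, hg, rfl⟩ := hg
    obtain ⟨h2, h3⟩ := Circuit.approxReflection_valid_within k s g hg
    exact h2.rename_of_injOn h3 (injOn_mod h)
  · intro g hg; simp at hg

theorem countP_reflectionCircuit (k s : ℕ) :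
    (reflectionCircuit k s).countP Gate.isHadamard = 2 * k * s ∧
      (reflectionCircuit k s).countP Gate.isPhase ≤ k * s ^ 2 ∧
      (reflectionCircuit k s).countP Gate.isCall ≤ k * 2 ^ (s + 1) := by
  unfold reflectionCircuit
  split_ifs with h
  · exact ⟨Circuit.countP_isHadamard_approxReflection _ _ _,
      Circuit.countP_isPhase_approxReflection _ _ _, Circuit.countP_isCall_approxReflection _ _ _⟩
  · refine ⟨?_, by simp, by simp⟩
    rw [mul_assoc, Nat.eq_zero_of_not_pos h]; rfl

/-! ### Error estimate for the circuit. -/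

namespace Circuit

variable {V : Type*} {Q : Type} [DecidableEq Q] [Fintype V]
  (U : EuclideanSpace ℂ V ≃ₗᵢ[ℂ] EuclideanSpace ℂ V)

theorem apply_idle_probes (q : ℕ → Q) (p s : ℕ) (Ψ : Joint V Q) :
    (probes (idleSchedule q p s)).apply U Ψ = Ψ := by
  have h (l : List (Q × ℕ)) (hl : ∀ x ∈ l, x.2 = 0) : (probes l).apply U Ψ = Ψ := by
    induction l with
    | nil => rfl
    | cons x l ih =>
      rw [probes, List.flatMap_cons, apply_append, probe, hl x List.mem_cons_self]
      simp only [List.replicate_zero, List.nil_append, apply_cons, apply_nil, hadamard_hadamard]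
      exact ih fun y hy => hl y (List.mem_cons_of_mem _ hy)
  refine h _ fun x hx => ?_
  simp only [idleSchedule, List.mem_flatMap, List.mem_map] at hx
  obtain ⟨_, -, _, -, rfl⟩ := hx
  rfl

variable [Fintype Q]

theorem inner_withZeros (Ψ : Joint V Q) (ψ : EuclideanSpace ℂ V) :
    inner ℂ Ψ (withZeros ψ) = inner ℂ (slice Ψ fun _ => false) ψ := by
  simp only [PiLp.inner_apply, Fintype.sum_prod_type, withZeros, slice]
  refine Finset.sum_congr rfl fun v _ => ?_
  rw [Finset.sum_eq_single fun _ => false]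
  · simp
  · intro b _ hb; simp [hb]
  · simp

variable {q : ℕ → Q} {k s : ℕ}

theorem approxReflection_of_fixed (hq : Set.InjOn q (Set.Iio (k * s)))
    {ψ : EuclideanSpace ℂ V} (hψ : U ψ = ψ) :
    (approxReflection q k s).apply U (withZeros ψ) = withZeros ψ := by
  unfold approxReflection
  split_ifs with h1 h2
  · rfl
  · rw [apply_append, apply_idle_probes, probes_of_fixed]
    intro b
    rw [slice_withZeros]; split_ifs <;> simp [hψ]
  · rw [not_or] at h1
    rw [apply_append, apply_append, apply_idle_probes, apply_idle_probes]
    exact phaseFlip_of_fixed U hq (Nat.mul_pos (by omega) (by omega)) (size_bound h1.2 h2) hψ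

/-- Fourth powers: 81 ≤ 128. This decides the cases k = 1 and k = 2 of the error bound. -/
theorem three_le_two_rpow : (3 : ℝ) ≤ 2 ^ (7 / 4 : ℝ) := by
  have h : (3 : ℝ) ^ 4 ≤ (2 ^ (7 / 4 : ℝ)) ^ 4 := by
    rw [← Real.rpow_natCast (2 ^ (7 / 4 : ℝ)), ← Real.rpow_mul zero_le_two]
    norm_num
  exact le_of_pow_le_pow_left₀ (by norm_num) (by positivity) h

/-- On an invariant subspace on which the unitary has a spectral gap, the circuit is close to
minus the identity. -/
theorem norm_approxReflection_add_le (hs0 : s ≠ 0) (hq : Set.InjOn q (Set.Iio (k * s)))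
    {K : Submodule ℂ (EuclideanSpace ℂ V)} (hK : ∀ ψ ∈ K, U ψ ∈ K) {g : ℝ}
    (hg : ∀ ψ ∈ K, g * ‖ψ‖ ≤ ‖ψ - U ψ‖) (hs : 4 ≤ g * 2 ^ s) {ψ : EuclideanSpace ℂ V}
    (hψ : ψ ∈ K) :
    ‖(approxReflection q k s).apply U (withZeros ψ) + withZeros ψ‖ ≤
      (2 : ℝ) ^ (1 - 1 / 16 * (k : ℝ)) * ‖ψ‖ := by
  unfold approxReflection
  split_ifs with h1 h2
  -- Here k = 0, and the claimed bound 2‖ψ‖ is exactly what the empty circuit gives.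
  · rw [apply_nil, ← two_smul ℂ, norm_smul, norm_withZeros, h1.resolve_right hs0]
    simp
  · rw [not_or] at h1
    rw [apply_append, apply_idle_probes]
    set Φ := (probes (schedule q 1 s)).apply U (withZeros ψ : Joint V Q) with hΦ
    have hnorm : ‖Φ‖ = ‖ψ‖ := by
      rw [hΦ, norm_apply U (probe_isHadamard_or_isCall _), norm_withZeros]
    have hslice : slice Φ (fun _ => false) = average U s ψ :=
      slice_zero_probes_schedule U hq (Nat.mul_le_mul (by omega) le_rfl) ψ
    have havg : ‖average U s ψ‖ ≤ 1 / 2 * ‖ψ‖ :=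
      norm_average_le U hs (hg _ (average_mem U hK s hψ))
    have hinner : RCLike.re (inner ℂ Φ (withZeros ψ)) ≤ 1 / 2 * ‖ψ‖ * ‖ψ‖ := by
      rw [inner_withZeros, hslice]
      refine (RCLike.re_le_norm _).trans ((norm_inner_le_norm _ _).trans ?_)
      gcongr
    -- Two vectors of norm ‖ψ‖ whose inner product has real part at most ‖ψ‖²/2: the factor is 1 + 1
    -- + 2·(1/2).
    have hsq : ‖Φ + withZeros ψ‖ ^ 2 ≤ 3 * ‖ψ‖ ^ 2 := by
      rw [norm_add_sq (𝕜 := ℂ), hnorm, norm_withZeros]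
      nlinarith
    refine le_of_sq_le_sq (hsq.trans ?_) (by positivity)
    rw [mul_pow, ← Real.rpow_mul_natCast zero_le_two]
    gcongr
    -- As k ≤ 2, the exponent 2(1 − k/16) is at least 7/4. This case is what keeps the rate below
    -- 1/4.
    refine three_le_two_rpow.trans (Real.rpow_le_rpow_of_exponent_le one_le_two ?_)
    have : (k : ℝ) ≤ 2 := by exact_mod_cast (by omega : k ≤ 2)
    push_cast
    linarith
  · rw [not_or] at h1
    rw [apply_append, apply_append, apply_idle_probes, apply_idle_probes,
      norm_phaseFlip_add U hq (Nat.mul_pos (by omega) (by omega)) (size_bound h1.2 h2)]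
    have h3 := norm_iterate_average_le U hK hg hs ((k - 1) / 2) hψ
    have h4 : (2 : ℝ) * (1 / 2) ^ ((k - 1) / 2) ≤ 2 ^ (1 - 1 / 16 * (k : ℝ)) := by
      have h5 : (2 : ℝ) * (1 / 2) ^ ((k - 1) / 2) = 2 ^ (1 - (((k - 1) / 2 : ℕ) : ℝ)) := by
        rw [Real.rpow_sub zero_lt_two, Real.rpow_one, Real.rpow_natCast, one_div, inv_pow,
          div_eq_mul_inv]
      rw [h5]
      refine Real.rpow_le_rpow_of_exponent_le one_le_two ?_
      -- From k ≤ 2m + 2 and m ≥ 1; the decay 2^(−m) thus even allows the rate 1/4.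
      have h6 : (k : ℝ) ≤ 4 * (((k - 1) / 2 : ℕ) : ℝ) := by
        exact_mod_cast (by omega : k ≤ 4 * ((k - 1) / 2))
      have h7 : (0 : ℝ) ≤ k := Nat.cast_nonneg k
      linarith
    calc 2 * ‖(average U s)^[(k - 1) / 2] ψ‖ ≤ 2 * ((1 / 2) ^ ((k - 1) / 2) * ‖ψ‖) := by gcongr
      _ = 2 * (1 / 2) ^ ((k - 1) / 2) * ‖ψ‖ := by ring
      _ ≤ _ := by gcongr

end Circuit

/-! ### Choice of the number of qubits per block. -/

section Precision

variable {V : Type*} [Fintype V] (U : EuclideanSpace ℂ V ≃ₗᵢ[ℂ] EuclideanSpace ℂ V) {k s : ℕ}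

theorem reflectionCircuit_of_fixed {ψ : EuclideanSpace ℂ V} (hψ : U ψ = ψ) :
    (reflectionCircuit k s).apply U (withZeros ψ) = withZeros ψ := by
  unfold reflectionCircuit
  split_ifs with h
  · exact Circuit.approxReflection_of_fixed U (injOn_mod h) hψ
  · rfl

theorem norm_reflectionCircuit_add_le (hs0 : s ≠ 0) {K : Submodule ℂ (EuclideanSpace ℂ V)}
    (hK : ∀ ψ ∈ K, U ψ ∈ K) {g : ℝ} (hg : ∀ ψ ∈ K, g * ‖ψ‖ ≤ ‖ψ - U ψ‖) (hs : 4 ≤ g * 2 ^ s)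
    {ψ : EuclideanSpace ℂ V} (hψ : ψ ∈ K) :
    ‖(reflectionCircuit k s).apply U (withZeros ψ) + withZeros ψ‖ ≤
      (2 : ℝ) ^ (1 - 1 / 16 * (k : ℝ)) * ‖ψ‖ := by
  unfold reflectionCircuit
  split_ifs with h
  · exact Circuit.norm_approxReflection_add_le U hs0 (injOn_mod h) hK hg hs hψ
  · have hk : k = 0 := by
      by_contra hk
      exact h (Nat.mul_pos (by omega) (by omega))
    rw [Circuit.apply_nil, ← two_smul ℂ, norm_smul, norm_withZeros, hk]
    simp

/-- A number of qubits that resolves the gap `Δ`. -/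
theorem exists_precision {Δ : ℝ} (h0 : 0 < Δ) (hπ : Δ ≤ Real.pi) :
    ∃ s : ℕ, s ≠ 0 ∧ |(s : ℝ) - Real.logb 2 (1 / Δ)| ≤ 5 ∧
      4 ≤ 2 * Real.sin (Δ / 2) * 2 ^ s := by
  have hp := Real.pi_pos
  have hL : Real.logb 2 (2 * Real.pi / Δ) = Real.logb 2 (2 * Real.pi) + Real.logb 2 (1 / Δ) := by
    rw [← Real.logb_mul (by positivity) (by positivity), mul_one_div]
  have h8 : Real.logb 2 (2 * Real.pi) ≤ 3 := by
    rw [Real.logb_le_iff_le_rpow one_lt_two (by positivity)]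
    norm_num
    linarith [Real.pi_le_four]
  have h1 : 0 ≤ Real.logb 2 (2 * Real.pi) :=
    Real.logb_nonneg one_lt_two (by linarith [Real.pi_gt_three])
  have h2 : 1 ≤ Real.logb 2 (2 * Real.pi / Δ) := by
    rw [Real.le_logb_iff_rpow_le one_lt_two (by positivity), Real.rpow_one, le_div_iff₀ h0]
    linarith
  have hceil := Nat.le_ceil (Real.logb 2 (2 * Real.pi / Δ))
  have hceil' := Nat.ceil_lt_add_one (zero_le_one.trans h2)
  -- Jordan's inequality gives 2 sin(Δ/2) ≥ 2Δ/π, and multiplication by 2π/Δ yields exactly 4. Since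
  -- 2π/Δ ≥ 2, the ceiling is positive, which excludes the empty circuit for s = 0.
  refine ⟨⌈Real.logb 2 (2 * Real.pi / Δ)⌉₊, ?_, ?_, ?_⟩
  · exact (Nat.ceil_pos.2 (zero_lt_one.trans_le h2)).ne'
  · rw [abs_le]
    constructor <;> linarith
  · have h3 : 2 * Real.pi / Δ ≤ 2 ^ ⌈Real.logb 2 (2 * Real.pi / Δ)⌉₊ := by
      rw [Real.logb_le_iff_le_rpow one_lt_two (by positivity), Real.rpow_natCast] at hceil
      exact hceil
    have h4 : 2 / Real.pi * (Δ / 2) ≤ Real.sin (Δ / 2) :=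
      Real.mul_le_sin (by linarith) (by linarith)
    have h5 : 0 ≤ 2 / Real.pi * (Δ / 2) := by positivity
    have h6 : 0 ≤ 2 * Real.sin (Δ / 2) := by linarith
    calc (4 : ℝ) = 2 * (2 / Real.pi * (Δ / 2)) * (2 * Real.pi / Δ) := by field_simp; norm_num
      _ ≤ _ := by gcongr

end Precision

/-! ### Specifications of programs with a bound on the steps. -/

namespace Prog

/-- Coefficient of a bound on the number of steps. -/
def coeff : Prog → ℕ
  | seq p q => p.coeff + q.coeff
  | ifZero _ p q => p.coeff + q.coeff + 1
  | loop _ p => p.coeff + 2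
  | _ => 1

/-- Nesting depth of the loops. -/
def depth : Prog → ℕ
  | seq p q => max p.depth q.depth
  | ifZero _ p q => max p.depth q.depth
  | loop _ p => p.depth + 1
  | _ => 0

/-- Started with registers `ρ`, the program ends with registers `ρ'` and prints `o`, in a number
of steps that is polynomial in `N`. -/
def Runs (N : ℕ) (p : Prog) (ρ ρ' : ℕ → ℕ) (o : List (Gate ℕ)) : Prop :=
  ∀ out st, ∃ n ≤ p.coeff * N ^ p.depth, p.exec ⟨ρ, out, st⟩ = ⟨ρ', out ++ o, st + n⟩

/-- The registers with contents `l`, and zero beyond. -/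
def regs (l : List ℕ) (r : ℕ) : ℕ := l.getD r 0

variable {N : ℕ} {p q : Prog} {ρ ρ₁ ρ' : ℕ → ℕ} {o o₁ o' : List (Gate ℕ)} {l : List ℕ} {r t : ℕ}

theorem regs_set (hr : r < l.length) (v : ℕ) :
    Function.update (regs l) r v = regs (l.set r v) := by
  funext i
  by_cases h : i = r
  · subst h
    simp [regs, hr]
  · rw [Function.update_of_ne h]
    simp [regs, List.getElem?_set_ne (Ne.symm h)]

namespace Runs

theorem cast (h : Runs N p ρ ρ₁ o₁) (hρ : ρ₁ = ρ') (ho : o₁ = o') : Runs N p ρ ρ' o' :=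
  hρ ▸ ho ▸ h

theorem skip : Runs N .skip ρ ρ [] := fun out st => ⟨1, by simp [coeff, depth], by simp [exec]⟩

theorem inc (h : r < l.length := by simp) :
    Runs N (.inc r) (regs l) (regs (l.set r (regs l r + 1))) [] := fun out st =>
  ⟨1, by simp [coeff, depth], by simp [exec, ← regs_set h]⟩

theorem dec (h : r < l.length := by simp) :
    Runs N (.dec r) (regs l) (regs (l.set r (regs l r - 1))) [] := fun out st =>
  ⟨1, by simp [coeff, depth], by simp [exec, ← regs_set h]⟩

theorem emit (g : Gate ℕ) : Runs N (.emit g) ρ ρ [g.rename ρ ρ] := fun out st =>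
  ⟨1, by simp [coeff, depth], by simp [exec]⟩

theorem seq (hN : 0 < N) (h : Runs N p ρ ρ₁ o) (h' : Runs N q ρ₁ ρ' o') :
    Runs N (.seq p q) ρ ρ' (o ++ o') := by
  intro out st
  obtain ⟨n, hn, e⟩ := h out st
  obtain ⟨n', hn', e'⟩ := h' (out ++ o) (st + n)
  refine ⟨n + n', ?_, ?_⟩
  · simp only [coeff, depth, add_mul]
    exact add_le_add
      (hn.trans (Nat.mul_le_mul_left _ (Nat.pow_le_pow_right hN (le_max_left _ _))))
      (hn'.trans (Nat.mul_le_mul_left _ (Nat.pow_le_pow_right hN (le_max_right _ _))))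
  · rw [exec, e, e', List.append_assoc, add_assoc]

theorem ifZero_of_eq (hN : 0 < N) (hr : ρ r = 0) (h : Runs N p ρ ρ' o) :
    Runs N (.ifZero r p q) ρ ρ' o := by
  intro out st
  obtain ⟨n, hn, e⟩ := h out (st + 1)
  refine ⟨1 + n, ?_, ?_⟩
  · simp only [coeff, depth, add_mul, one_mul]
    have h1 := hn.trans (Nat.mul_le_mul_left _
      (Nat.pow_le_pow_right hN (le_max_left p.depth q.depth)))
    have h2 := Nat.pos_of_ne_zero (pow_ne_zero (max p.depth q.depth) hN.ne')
    omega
  · simp only [exec, hr, if_true, e, add_assoc]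

theorem ifZero_of_ne (hN : 0 < N) (hr : ρ r ≠ 0) (h : Runs N q ρ ρ' o) :
    Runs N (.ifZero r p q) ρ ρ' o := by
  intro out st
  obtain ⟨n, hn, e⟩ := h out (st + 1)
  refine ⟨1 + n, ?_, ?_⟩
  · simp only [coeff, depth, add_mul, one_mul]
    have h1 := hn.trans (Nat.mul_le_mul_left _
      (Nat.pow_le_pow_right hN (le_max_right p.depth q.depth)))
    have h2 := Nat.pos_of_ne_zero (pow_ne_zero (max p.depth q.depth) hN.ne')
    omega
  · simp only [exec, hr, if_false, e, add_assoc]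

/-- The family ρ is the loop invariant. At most N rounds cost `p.coeff * N ^ p.depth + 1` each; the
extra step per round and the start of the loop account for the 2 added in `coeff`. -/
theorem loop {ρ : ℕ → ℕ → ℕ} {o : ℕ → List (Gate ℕ)} {n : ℕ} (hN : 0 < N) (hr : ρ 0 r = n)
    (hn : n ≤ N) (h : ∀ i < n, Runs N p (ρ i) (ρ (i + 1)) (o i)) :
    Runs N (.loop r p) (ρ 0) (ρ n) ((List.range n).flatMap o) := by
  have key : ∀ j ≤ n, ∀ out st, ∃ c ≤ j * (p.coeff * N ^ p.depth + 1),
      (fun e : Config => p.exec { e with steps := e.steps + 1 })^[j] ⟨ρ 0, out, st⟩ =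
        ⟨ρ j, out ++ (List.range j).flatMap o, st + c⟩ := by
    intro j hj out st
    induction j with
    | zero => exact ⟨0, by simp, by simp⟩
    | succ j ih =>
      obtain ⟨c, hc, e⟩ := ih (by omega)
      obtain ⟨c', hc', e'⟩ := h j (by omega) (out ++ (List.range j).flatMap o) (st + c + 1)
      refine ⟨c + (1 + c'), ?_, ?_⟩
      · rw [add_mul, one_mul]; omega
      · rw [Function.iterate_succ_apply', e]
        simp only [e']
        rw [List.range_succ, List.flatMap_append, List.flatMap_singleton, List.append_assoc,
          add_assoc, add_assoc]
  intro out st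
  obtain ⟨c, hc, e⟩ := key n le_rfl out (st + 1)
  refine ⟨1 + c, ?_, ?_⟩
  · have h1 : c ≤ N * (p.coeff * N ^ p.depth + 1) := hc.trans (Nat.mul_le_mul_right _ hn)
    have h2 : N ≤ N ^ (p.depth + 1) := Nat.le_self_pow (by omega) N
    calc 1 + c ≤ 1 + (p.coeff * N ^ (p.depth + 1) + N) := by
          rw [pow_succ]; refine Nat.add_le_add_left (h1.trans (le_of_eq (by ring))) 1
      _ ≤ p.coeff * N ^ (p.depth + 1) + 2 * N ^ (p.depth + 1) := by omega
      _ = _ := by simp only [coeff, depth, add_mul]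
  · simp only [exec, hr, e, add_assoc]

/-- A loop whose rounds are indexed downwards. -/
theorem loop_reverse {ρ : ℕ → ℕ → ℕ} {o : ℕ → List (Gate ℕ)} {n : ℕ} (hN : 0 < N)
    (hr : ρ n r = n) (hn : n ≤ N) (h : ∀ i < n, Runs N p (ρ (i + 1)) (ρ i) (o i)) :
    Runs N (.loop r p) (ρ n) (ρ 0) ((List.range n).reverse.flatMap o) := by
  have h1 := loop (p := p) (ρ := fun i => ρ (n - i)) (o := fun i => o (n - 1 - i)) (r := r) hN hr hn
    fun i hi => by
      have h2 := h (n - 1 - i) (by omega)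
      rw [show n - 1 - i + 1 = n - i by omega] at h2
      simp only [show n - (i + 1) = n - 1 - i by omega]
      exact h2
  refine h1.cast (by simp) ?_
  rw [List.range_eq_range', List.reverse_range', List.flatMap_map, ← List.range_eq_range']
  simp only [zero_add]

end Runs

/-- Set register `r` to zero. -/
def clear (r : ℕ) : Prog := .loop r (.dec r)

/-- Add register `r` to register `t`. -/
def addTo (r t : ℕ) : Prog := .loop r (.inc t)

namespace Runs

/-- The number of rounds is fixed on entry, so decrementing the counter inside the loop does not
shorten it. -/
theorem clear (hN : 0 < N) (hl : regs l r ≤ N) (h : r < l.length := by simp) :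
    Runs N (Prog.clear r) (regs l) (regs (l.set r 0)) [] := by
  have h1 := loop_reverse (ρ := fun i => regs (l.set r i)) (o := fun _ => []) (r := r)
    (p := .dec r) (n := regs l r) hN (by simp [regs, h]) hl fun i _ => by
      refine (dec (l := l.set r (i + 1)) (r := r) (by simpa using h)).cast ?_ rfl
      simp [regs, h]
  have h2 : l.set r (regs l r) = l := by simp [regs, h]
  simp only [h2] at h1
  exact h1.cast rfl (by simp)

theorem addTo (hN : 0 < N) (hl : regs l r ≤ N) (hrt : t ≠ r) (h : t < l.length := by simp) :
    Runs N (Prog.addTo r t) (regs l) (regs (l.set t (regs l t + regs l r))) [] := by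
  have h2 : l.set t (regs l t + 0) = l := by simp [regs, h]
  have h1 := loop (ρ := fun i => regs (l.set t (regs l t + i))) (o := fun _ => []) (r := r)
    (p := .inc t) (n := regs l r) hN
    (by simp [regs, List.getElem?_set_ne hrt]) hl fun i _ => by
      refine (inc (l := l.set t (regs l t + i)) (r := t) (by simpa using h)).cast ?_ rfl
      simp [regs, h, add_assoc]
  simp only [h2] at h1
  exact h1.cast rfl (by simp)

end Runs

/-! ### The program that prints the circuit. -/

/-- Print the two Hadamard gates of an idle probe for each of the qubits in turn. -/
def emitIdle : Prog :=
  .seq (.loop 1 (.seq (.emit (.hadamard 4)) (.seq (.emit (.hadamard 4)) (.inc 4)))) (clear 4)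

/-- Print a probe of qubit `4` with `2 ^ e` calls, where `e` is in register `5`. -/
def emitProbe (g : Gate ℕ) : Prog :=
  .seq (.inc 6) <| .seq (.loop 5 (.seq (addTo 6 7) (.seq (addTo 7 6) (clear 7)))) <|
    .seq (.emit (.hadamard 4)) <| .seq (.loop 6 (.emit g)) <|
      .seq (.emit (.hadamard 4)) (clear 6)

/-- Register 4 holds the current qubit and 5 the exponent; 6 and 7 compute powers of two. Register 4
is not reset, so consecutive blocks use consecutive qubits. -/
def emitBlock : Prog := .loop 1 (.seq (emitProbe (.call 4)) (.seq (.inc 4) (.inc 5)))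

/-- Starting just past the block, qubit and exponent are decremented before each probe, which yields
the reversed order. -/
def emitBlockInv : Prog :=
  .seq (addTo 1 5) (.loop 1 (.seq (.dec 4) (.seq (.dec 5) (emitProbe (.callInv 4)))))

def emitLink : Prog :=
  .seq (.emit (.not 4)) (.seq (.emit (.toffoli 8 4 9)) (.emit (.not 4)))

/-- Register 10 is both the number of controls and the index of the first work qubit, which
coincide. Registers 8 and 9 run through consecutive work qubits, and 11 holds the rotation parameter
1. -/
def emitFlip : Prog :=
  .seq (.emit (.not 10)) <|
  .seq (.loop 10 (.seq emitLink (.seq (.inc 4) (.seq (.inc 8) (.inc 9))))) <|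
  .seq (.emit (.not 8)) <| .seq (.emit (.cphase 10 8 11 false)) <| .seq (.emit (.not 8)) <|
  .seq (.loop 10 (.seq (.dec 4) (.seq (.dec 8) (.seq (.dec 9) emitLink)))) (.emit (.not 10))

/-- Copy the number of control qubits, which is in register `4`, to the registers `8` to `10`,
set up the rotation parameter, and reset register `4`. -/
def prepareFlip : Prog :=
  .seq (addTo 4 8) <| .seq (addTo 4 9) <| .seq (.inc 9) <| .seq (addTo 4 10) <|
    .seq (.inc 11) (clear 4)

def emitPhaseFlip : Prog :=
  .seq (.loop 3 (.seq emitBlock (clear 5))) <| .seq prepareFlip <| .seq emitFlip <|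
    .seq (addTo 10 4) (.loop 3 emitBlockInv)

/-- Divide register `0` by two, with the quotient in register `3` and the remainder in `2`. -/
def halve : Prog := .loop 0 (.ifZero 2 (.inc 2) (.seq (.dec 2) (.inc 3)))

def emitReflection : Prog :=
  .ifZero 0 .skip <| .ifZero 1 .skip <| .seq (.dec 0) <| .seq halve <| .seq (.loop 2 emitIdle) <|
    .ifZero 3 emitBlock (.seq emitIdle emitPhaseFlip)

section Spec

variable {k s m e L : ℕ}

theorem runs_emitIdle (hN : 0 < N) (hs : s ≤ N) (k p m : ℕ) :
    Runs N emitIdle (regs [k, s, p, m, 0, 0, 0, 0, 0, 0, 0, 0])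
      (regs [k, s, p, m, 0, 0, 0, 0, 0, 0, 0, 0])
      ((List.range s).flatMap fun j => Circuit.probe (j, 0)) := by
  have h1 := Runs.loop (r := 1)
    (ρ := fun j => regs [k, s, p, m, j, 0, 0, 0, 0, 0, 0, 0])
    (o := fun j => Circuit.probe (j, 0)) hN rfl hs fun j _ =>
      Runs.cast (Runs.seq hN (Runs.emit (.hadamard 4)) (Runs.seq hN (Runs.emit (.hadamard 4))
        (Runs.inc (r := 4)))) rfl rfl
  exact Runs.cast (Runs.seq hN h1 (Runs.clear (r := 4) hN hs)) rfl (List.append_nil _)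

theorem flatMap_range_const (n : ℕ) (g : Gate ℕ) :
    ((List.range n).flatMap fun _ => [g]) = List.replicate n g := by
  induction n with
  | zero => rfl
  | succ n ih => rw [List.range_succ, List.flatMap_append, ih, List.replicate_succ']; rfl

theorem runs_emitProbe (hN : 0 < N) (he : 2 ^ e ≤ N) (g : Gate ℕ) (k s p m i : ℕ)
    (a a' L c : ℕ) {g' : Gate ℕ}
    (hg : ∀ t, g.rename (regs [k, s, p, m, i, e, t, 0, a, a', L, c])
      (regs [k, s, p, m, i, e, t, 0, a, a', L, c]) = g') :
    Runs N (emitProbe g) (regs [k, s, p, m, i, e, 0, 0, a, a', L, c])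
      (regs [k, s, p, m, i, e, 0, 0, a, a', L, c])
      (.hadamard i :: (List.replicate (2 ^ e) g' ++ [.hadamard i])) := by
  -- Each round doubles register 6 by way of register 7, taking 2^j to 2^(j+1).
  have h2 := Runs.loop (r := 5)
    (p := .seq (addTo 6 7) (.seq (addTo 7 6) (clear 7)))
    (ρ := fun j => regs [k, s, p, m, i, e, 2 ^ j, 0, a, a', L, c])
    (o := fun _ => []) hN rfl ((Nat.lt_two_pow_self).le.trans he) fun j hj => by
      have hj' : 2 ^ j ≤ N := (Nat.pow_le_pow_right (by omega) hj.le).trans he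
      have hj'' : 0 + 2 ^ j ≤ N := by rwa [zero_add]
      refine Runs.cast (Runs.seq hN (Runs.addTo (r := 6) (t := 7) hN hj' (by omega))
        (Runs.seq hN (Runs.addTo (r := 7) (t := 6) hN hj'' (by omega))
          (Runs.clear (r := 7) hN hj''))) ?_ rfl
      change regs [k, s, p, m, i, e, 2 ^ j + (0 + 2 ^ j), 0, a, a', L, c] = _
      rw [zero_add, pow_succ, mul_two]
  have h4 := Runs.loop (r := 6) (p := .emit g)
    (ρ := fun _ => regs [k, s, p, m, i, e, 2 ^ e, 0, a, a', L, c])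
    (o := fun _ => [g']) hN rfl he fun j _ => Runs.cast (Runs.emit g) rfl (by rw [hg])
  rw [flatMap_range_const] at h4
  refine Runs.cast (Runs.seq hN (Runs.inc (r := 6)) (Runs.seq hN h2
    (Runs.seq hN (Runs.emit (.hadamard 4))
    (Runs.seq hN h4 (Runs.seq hN (Runs.emit (.hadamard 4))
      (Runs.clear (r := 6) hN he)))))) rfl ?_
  simp [Gate.rename, regs]

theorem runs_emitBlock (hN : 0 < N) (hs : 2 ^ s ≤ N) (k p m i : ℕ) :
    Runs N emitBlock (regs [k, s, p, m, i, 0, 0, 0, 0, 0, 0, 0])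
      (regs [k, s, p, m, i + s, s, 0, 0, 0, 0, 0, 0])
      ((List.range s).flatMap fun j => Circuit.probe (i + j, 2 ^ j)) :=
  Runs.loop (r := 1) (ρ := fun j => regs [k, s, p, m, i + j, j, 0, 0, 0, 0, 0, 0])
    (o := fun j => Circuit.probe (i + j, 2 ^ j)) hN rfl (Nat.lt_two_pow_self.le.trans hs)
    fun j hj => by
      have hj' : 2 ^ j ≤ N := (Nat.pow_le_pow_right (by omega) hj.le).trans hs
      refine Runs.cast (Runs.seq hN (runs_emitProbe hN hj' (.call 4) k s p m (i + j) 0 0 0 0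
        (g' := .call (i + j)) fun t => rfl) (Runs.seq hN (Runs.inc (r := 4))
          (Runs.inc (r := 5)))) rfl ?_
      simp [Circuit.probe]

theorem runs_emitBlockInv (hN : 0 < N) (hs : 2 ^ s ≤ N) (k p m i a a' L c : ℕ) :
    Runs N emitBlockInv (regs [k, s, p, m, i + s, 0, 0, 0, a, a', L, c])
      (regs [k, s, p, m, i, 0, 0, 0, a, a', L, c])
      ((List.range s).reverse.flatMap fun j => Circuit.probeInv (i + j, 2 ^ j)) := by
  have hs' : s ≤ N := Nat.lt_two_pow_self.le.trans hs
  have h1 := Runs.loop_reverse (r := 1)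
    (p := .seq (.dec 4) (.seq (.dec 5) (emitProbe (.callInv 4))))
    (ρ := fun j => regs [k, s, p, m, i + j, j, 0, 0, a, a', L, c])
    (o := fun j => Circuit.probeInv (i + j, 2 ^ j)) hN rfl hs' fun j hj => by
      have hj' : 2 ^ j ≤ N := (Nat.pow_le_pow_right (by omega) hj.le).trans hs
      have h2 : Runs N (.dec 4) (regs [k, s, p, m, i + (j + 1), j + 1, 0, 0, a, a', L, c])
          (regs [k, s, p, m, i + j, j + 1, 0, 0, a, a', L, c]) [] := Runs.dec
      have h3 : Runs N (.dec 5) (regs [k, s, p, m, i + j, j + 1, 0, 0, a, a', L, c])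
          (regs [k, s, p, m, i + j, j, 0, 0, a, a', L, c]) [] := Runs.dec
      exact Runs.seq hN h2 (Runs.seq hN h3
        (runs_emitProbe hN hj' (.callInv 4) k s p m (i + j) a a' L c
          (g' := .callInv (i + j)) fun t => rfl))
  have h0 : Runs N (addTo 1 5) (regs [k, s, p, m, i + s, 0, 0, 0, a, a', L, c])
      (regs [k, s, p, m, i + s, s, 0, 0, a, a', L, c]) [] := by
    refine Runs.cast (Runs.addTo (r := 1) (t := 5) hN hs' (by omega)) ?_ rfl
    change regs [k, s, p, m, i + s, 0 + s, 0, 0, a, a', L, c] = _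
    rw [zero_add]
  exact Runs.seq hN h0 h1

theorem runs_emitLink (hN : 0 < N) (k s p m i a a' L c : ℕ) :
    Runs N emitLink (regs [k, s, p, m, i, 0, 0, 0, a, a', L, c])
      (regs [k, s, p, m, i, 0, 0, 0, a, a', L, c])
      [.not i, .toffoli a i a', .not i] :=
  Runs.cast (Runs.seq hN (Runs.emit (.not 4)) (Runs.seq hN (Runs.emit (.toffoli 8 4 9))
    (Runs.emit (.not 4)))) rfl rfl

theorem runs_emitFlip (hN : 0 < N) (hL : L ≤ N) (k s p m : ℕ) :
    Runs N emitFlip (regs [k, s, p, m, 0, 0, 0, 0, L, L + 1, L, 1])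
      (regs [k, s, p, m, 0, 0, 0, 0, L, L + 1, L, 1])
      (Circuit.flipSome id (fun i => id (L + i)) L) := by
  have h1 := Runs.loop (r := 10) (p := .seq emitLink (.seq (.inc 4) (.seq (.inc 8) (.inc 9))))
    (ρ := fun j => regs [k, s, p, m, j, 0, 0, 0, L + j, L + j + 1, L, 1])
    (o := fun j => [.not j, .toffoli (L + j) j (L + j + 1), .not j]) hN rfl hL fun j hj =>
      Runs.cast (Runs.seq hN (runs_emitLink hN k s p m j (L + j) (L + j + 1) L 1)
        (Runs.seq hN (Runs.inc (r := 4)) (Runs.seq hN (Runs.inc (r := 8))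
          (Runs.inc (r := 9))))) rfl rfl
  have h2 := Runs.loop_reverse (r := 10)
    (p := .seq (.dec 4) (.seq (.dec 8) (.seq (.dec 9) emitLink)))
    (ρ := fun j => regs [k, s, p, m, j, 0, 0, 0, L + j, L + j + 1, L, 1])
    (o := fun j => [.not j, .toffoli (L + j) j (L + j + 1), .not j]) hN rfl hL fun j hj =>
      Runs.cast (Runs.seq hN (Runs.dec (r := 4)) (Runs.seq hN (Runs.dec (r := 8))
        (Runs.seq hN (Runs.dec (r := 9))
          (runs_emitLink hN k s p m j (L + j) (L + j + 1) L 1)))) rfl rfl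
  exact Runs.cast (Runs.seq hN (Runs.emit (.not 10)) (Runs.seq hN h1
    (Runs.seq hN (Runs.emit (.not 8))
    (Runs.seq hN (Runs.emit (.cphase 10 8 11 false)) (Runs.seq hN (Runs.emit (.not 8))
      (Runs.seq hN h2 (Runs.emit (.not 10)))))))) rfl rfl

theorem runs_prepareFlip (hN : 0 < N) (hL : L ≤ N) (k s p m : ℕ) :
    Runs N prepareFlip (regs [k, s, p, m, L, 0, 0, 0, 0, 0, 0, 0])
      (regs [k, s, p, m, 0, 0, 0, 0, L, L + 1, L, 1]) [] := by
  refine Runs.cast (Runs.seq hN (Runs.addTo (r := 4) (t := 8) hN hL (by omega))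
    (Runs.seq hN (Runs.addTo (r := 4) (t := 9) hN hL (by omega))
    (Runs.seq hN (Runs.inc (r := 9))
    (Runs.seq hN (Runs.addTo (r := 4) (t := 10) hN hL (by omega))
    (Runs.seq hN (Runs.inc (r := 11)) (Runs.clear (r := 4) hN hL)))))) ?_ rfl
  change regs [k, s, p, m, 0, 0, 0, 0, 0 + L, 0 + L + 1, 0 + L, 1] = _
  rw [zero_add]

theorem runs_emitPhaseFlip (hN : 0 < N) (hs : 2 ^ s ≤ N) (hm : m ≤ N) (hL : m * s ≤ N)
    (k p : ℕ) : ∃ ρ, Runs N emitPhaseFlip (regs [k, s, p, m, 0, 0, 0, 0, 0, 0, 0, 0]) ρ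
      (Circuit.phaseFlip id m s) := by
  have hs' : s ≤ N := Nat.lt_two_pow_self.le.trans hs
  have h1 := Runs.loop (r := 3) (p := .seq emitBlock (clear 5))
    (n := m) (ρ := fun b => regs [k, s, p, m, b * s, 0, 0, 0, 0, 0, 0, 0])
    (o := fun b => (List.range s).flatMap fun j => Circuit.probe (b * s + j, 2 ^ j)) hN rfl hm
    fun b hb => by
      refine Runs.cast (Runs.seq hN (runs_emitBlock hN hs k p m (b * s))
        (Runs.clear (r := 5) hN hs')) ?_ (List.append_nil _)
      rw [add_one_mul]; rfl
  have h3 : Runs N (addTo 10 4)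
      (regs [k, s, p, m, 0, 0, 0, 0, m * s, m * s + 1, m * s, 1])
      (regs [k, s, p, m, m * s, 0, 0, 0, m * s, m * s + 1, m * s, 1]) [] := by
    refine Runs.cast (Runs.addTo (r := 10) (t := 4) hN hL (by omega)) ?_ rfl
    change regs [k, s, p, m, 0 + m * s, 0, 0, 0, m * s, m * s + 1, m * s, 1] = _
    rw [zero_add]
  have h4 := Runs.loop_reverse (r := 3) (p := emitBlockInv)
    (n := m) (ρ := fun b => regs [k, s, p, m, b * s, 0, 0, 0, m * s, m * s + 1, m * s, 1])
    (o := fun b => (List.range s).reverse.flatMap fun j => Circuit.probeInv (b * s + j, 2 ^ j))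
    hN rfl hm fun b hb => by
      have := runs_emitBlockInv hN hs k p m (b * s) (m * s) (m * s + 1) (m * s) 1
      rwa [← add_one_mul] at this
  have h0 : [k, s, p, m, 0, 0, 0, 0, 0, 0, 0, 0] = [k, s, p, m, 0 * s, 0, 0, 0, 0, 0, 0, 0] := by
    rw [zero_mul]
  rw [h0]
  refine ⟨_, Runs.cast (Runs.seq hN h1 (Runs.seq hN (runs_prepareFlip hN hL k s p m)
    (Runs.seq hN (runs_emitFlip hN hL k s p m) (Runs.seq hN h3 h4)))) rfl ?_⟩
  simp [Circuit.phaseFlip, Circuit.probes, Circuit.probesInv, schedule, List.reverse_flatMap,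
    List.flatMap_assoc, List.flatMap_map, ← List.map_reverse]

theorem runs_halve (hN : 0 < N) (hk : k ≤ N) (s : ℕ) :
    Runs N halve (regs [k, s, 0, 0, 0, 0, 0, 0, 0, 0, 0, 0])
      (regs [k, s, k % 2, k / 2, 0, 0, 0, 0, 0, 0, 0, 0]) [] := by
  have h := Runs.loop (r := 0) (p := .ifZero 2 (.inc 2) (.seq (.dec 2) (.inc 3)))
    (n := k) (ρ := fun j => regs [k, s, j % 2, j / 2, 0, 0, 0, 0, 0, 0, 0, 0])
    (o := fun _ => []) hN rfl hk
    fun j _ => by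
      rcases Nat.mod_two_eq_zero_or_one j with hj | hj
      · rw [hj, show (j + 1) % 2 = 1 by omega, show (j + 1) / 2 = j / 2 by omega]
        exact Runs.ifZero_of_eq hN rfl (Runs.cast (Runs.inc (r := 2)) rfl rfl)
      · rw [hj, show (j + 1) % 2 = 0 by omega, show (j + 1) / 2 = j / 2 + 1 by omega]
        exact Runs.ifZero_of_ne hN one_ne_zero
          (Runs.cast (Runs.seq hN (Runs.dec (r := 2)) (Runs.inc (r := 3))) rfl rfl)
  exact h.cast rfl (by simp)

theorem runs_emitReflection (hN : 0 < N) (hs : 2 ^ s ≤ N) (hk : k ≤ N) (hks : k * s ≤ N) :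
    ∃ ρ, Runs N emitReflection (regs [k, s, 0, 0, 0, 0, 0, 0, 0, 0, 0, 0]) ρ
      (Circuit.approxReflection id k s) := by
  have hs' : s ≤ N := Nat.lt_two_pow_self.le.trans hs
  unfold Circuit.approxReflection
  by_cases hk0 : k = 0
  · exact ⟨_, Runs.ifZero_of_eq hN hk0 (Runs.skip.cast rfl (by rw [if_pos (Or.inl hk0)]))⟩
  by_cases hs0 : s = 0
  · exact ⟨_, Runs.ifZero_of_ne hN hk0 (Runs.ifZero_of_eq hN hs0
      (Runs.skip.cast rfl (by rw [if_pos (Or.inr hs0)])))⟩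
  rw [if_neg (by tauto)]
  suffices h : ∃ ρ, Runs N (.ifZero 3 emitBlock (.seq emitIdle emitPhaseFlip))
      (regs [k - 1, s, (k - 1) % 2, (k - 1) / 2, 0, 0, 0, 0, 0, 0, 0, 0]) ρ
      (if (k - 1) / 2 = 0 then Circuit.probes (schedule id 1 s)
        else Circuit.probes (Circuit.idleSchedule id 1 s) ++
          Circuit.phaseFlip id ((k - 1) / 2) s) by
    obtain ⟨ρ, h⟩ := h
    have h1 := Runs.loop (r := 2) (p := emitIdle)
      (ρ := fun _ => regs [k - 1, s, (k - 1) % 2, (k - 1) / 2, 0, 0, 0, 0, 0, 0, 0, 0])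
      (o := fun _ => (List.range s).flatMap fun j => Circuit.probe (j, 0)) (n := (k - 1) % 2)
      hN rfl (by omega) fun j _ => runs_emitIdle hN hs' _ _ _
    refine ⟨ρ, Runs.ifZero_of_ne hN hk0 (Runs.ifZero_of_ne hN hs0
      (Runs.cast (Runs.seq hN (Runs.dec (r := 0))
        (Runs.seq hN (runs_halve (k := k - 1) hN (by omega) s)
        (Runs.seq hN h1 h))) rfl ?_))⟩
    simp [Circuit.probes, Circuit.idleSchedule, List.flatMap_assoc, List.flatMap_map]
  split_ifs with hm
  · refine ⟨_, Runs.ifZero_of_eq hN hm ((runs_emitBlock hN hs _ _ _ _).cast rfl ?_)⟩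
    simp [Circuit.probes, schedule, List.flatMap_map]
  · have hL : (k - 1) / 2 * s ≤ N := (Nat.mul_le_mul_right s (by omega)).trans hks
    obtain ⟨ρ, h⟩ := runs_emitPhaseFlip hN hs (m := (k - 1) / 2) (by omega) hL (k - 1)
      ((k - 1) % 2)
    refine ⟨ρ, Runs.ifZero_of_ne hN hm
      (Runs.cast (Runs.seq hN (runs_emitIdle hN hs' _ _ _) h) rfl ?_)⟩
    simp [Circuit.probes, Circuit.idleSchedule, List.flatMap_map]

end Spec

end Prog

theorem isUniform_reflectionCircuit : IsUniform reflectionCircuit := by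
  -- All loop counts are at most N = (k + 2^s)², since it dominates k, 2^s and ks; the square
  -- accounts for the factor 2 in front of the depth.
  refine ⟨.emitReflection, max Prog.emitReflection.coeff (2 * Prog.emitReflection.depth),
    fun k s => ?_⟩
  have h1 : 1 ≤ k + 2 ^ s := Nat.one_le_two_pow.trans (Nat.le_add_left _ _)
  have h2 : k + 2 ^ s ≤ (k + 2 ^ s) ^ 2 := Nat.le_self_pow (by omega) _
  obtain ⟨ρ, h⟩ := Prog.runs_emitReflection (N := (k + 2 ^ s) ^ 2) (k := k) (s := s)
    (pow_pos h1 2) ((Nat.le_add_left _ _).trans h2) ((Nat.le_add_right _ _).trans h2)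
    (by
      rw [sq]
      exact Nat.mul_le_mul (Nat.le_add_right _ _)
        (Nat.lt_two_pow_self.le.trans (Nat.le_add_left _ _)))
  obtain ⟨n, hn, e⟩ := h [] 0
  have hstart : Config.start k s = ⟨Prog.regs [k, s, 0, 0, 0, 0, 0, 0, 0, 0, 0, 0], [], 0⟩ := by
    unfold Config.start
    congr 1
    funext r
    rcases r with _ | _ | r
    · rfl
    · rfl
    · have : r + 2 < 12 ∨ 12 ≤ r + 2 := by omega
      rcases this with h | h
      · have : r < 10 := by omega
        interval_cases r <;> rfl
      · simp [Prog.regs, h]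
  rw [hstart, e, map_rename_reflectionCircuit]
  refine ⟨rfl, ?_⟩
  rw [zero_add]
  refine hn.trans ?_
  rw [← pow_mul]
  exact Nat.mul_le_mul (le_max_left _ _) (Nat.pow_le_pow_right h1 (le_max_right _ _))

end QWalk

end

theorem mainTheorem3 :
    ∃ (c : ℝ) (C : ℕ) (R : (k s : ℕ) → QWalk.Circuit (Fin (k * s))),
      0 < c ∧ QWalk.IsUniform R ∧ (∀ k s : ℕ, (R k s).Valid) ∧
      ∀ (X : Type*) [Fintype X] [DecidableEq X] (P : Matrix X X ℝ) (π : X → ℝ),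
        QWalk.IsErgodic P → QWalk.IsStationary P π → QWalk.IsReversible P π →
        ∃ s : ℕ, |(s : ℝ) - Real.logb 2 (1 / QWalk.phaseGap P π)| ≤ C ∧
          ∀ k : ℕ,
            (R k s).countP QWalk.Gate.isHadamard = 2 * k * s ∧
            (R k s).countP QWalk.Gate.isPhase ≤ C * (k * s ^ 2) ∧
            (R k s).countP QWalk.Gate.isCall ≤ k * 2 ^ (s + 1) ∧
            (R k s).apply (QWalk.walk P π) (QWalk.withZeros (QWalk.stationaryState P π)) =
              QWalk.withZeros (QWalk.stationaryState P π) ∧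
            ∀ ψ ∈ QWalk.spaceA P ⊔ QWalk.spaceB P π,
              inner ℂ (QWalk.stationaryState P π) ψ = 0 →
              ‖(R k s).apply (QWalk.walk P π) (QWalk.withZeros ψ) + QWalk.withZeros ψ‖ ≤
                (2 : ℝ) ^ (1 - c * (k : ℝ)) * ‖ψ‖ := by
  -- The rate 1/16 suits the cases k = 1, 2. The number 5 exceeds log₂(2π) + 1, the largest
  -- deviation of s from log₂(1/Δ).
  refine ⟨1 / 16, 5, QWalk.reflectionCircuit, by norm_num, QWalk.isUniform_reflectionCircuit,
    QWalk.reflectionCircuit_valid, ?_⟩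
  intro X _ _ P π hP hπ hR
  obtain ⟨s, hs0, hs, hgap⟩ :=
    QWalk.exists_precision (QWalk.phaseGap_pos P π) (QWalk.phaseGap_le_pi P π)
  refine ⟨s, by exact_mod_cast hs, fun k => ?_⟩
  obtain ⟨h1, h2, h3⟩ := QWalk.countP_reflectionCircuit k s
  refine ⟨h1, h2.trans (by omega), h3,
    QWalk.reflectionCircuit_of_fixed _ (QWalk.walk_stationaryState hP hπ hR), ?_⟩
  intro ψ hψ hort
  exact QWalk.norm_reflectionCircuit_add_le _ hs0
    (fun φ hφ => QWalk.walk_mem_busySpace hP hπ hR hφ)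
    (fun φ hφ => QWalk.norm_sub_walk_ge hP hπ hR hφ) hgap (QWalk.mem_busySpace.2 ⟨hψ, hort⟩)
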